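/- Let $-1<q<1$. For a function $f$ put $(D_{q,x}f)(x)=\frac{f(x)-f(qx)}{x-qx}$ ($x\neq 0$). Let $-\infty\le A<0<B\le\infty$, let $V$ be a positive function on $(A,B)$ and let $\mu$ be a positive measure on $\mathbb R$ with compact support. Probability measures $w(m,u)\,\mu(du)$, $m\in(A,B)$, form a $q$-exponential family with variance function $V$, generated by $\mu$, if for all $u\in\operatorname{supp}\mu$ we have $\lim_{t\to0}w(t,u)=w(0,u)=1$ and $$D_{q,m}w(m,u)=w(m,u)\,\frac{u-m}{V(m)}$$ for all $m\neq0$ such that $m,qm\in(A,B)$ (for $q\ge 0$, this is all $m\in(A,B)\setminus\{0\}$). **Theorem.** Consider a $q$-exponential family with variance function $V(m)=1+am+bm^2$, where $b>-1+\max\{q,0\}$. 1. For all $m\in(A,B)$ with $qm\in(A,B)$ and all $u\in\operatorname{supp}\mu$, $$w(m,u)=\prod_{k=0}^\infty\frac{1+amq^k+bm^2q^{2k}}{1+(a-(1-q)u)mq^k+(b+1-q)m^2q^{2k}},$$ where no denominator vanishes and the product converges unconditionally. 2. $\mu$ is a uniquely determined probability measure: all $q$-exponential families with this $q$ and this $V$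 (on whatever interval) are generated by the same $\mu$. It is the unique probability measure with respect to which the Al-Salam–Chihara polynomials $p_n$ are orthogonal, where $p_{-1}=0$, $p_0=1$ and $$u\,p_n(u)=p_{n+1}(u)+a[n]_qp_n(u)+(1+b[n-1]_q)[n]_qp_{n-1}(u)\quad(n\ge 0),\qquad [n]_q=1+q+\dots+q^{n-1},\ [0]_q=0.$$ (Orthogonality means that all moments are finite, $\int p_mp_n\,d\mu=0$ for $m\ne n$, and $\int p_n^2\,d\mu>0$.) 3. The absolutely continuous part of $\mu$ (with respect to Lebesgue measure) is concentrated on the open interval $$\frac{a}{1-q}-\frac{2\sqrt{b+1-q}}{1-q}<u<\frac{a}{1-q}+\frac{2\sqrt{b+1-q}}{1-q},$$ and its topological support is the closure of this interval. 4. If $a^2<4b$, then $\mu$ has no discrete part, i.e. $\mu(\{x\})=0$ for every $x\in\mathbb R$. -/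

import Mathlib

open MeasureTheory Filter Topology

noncomputable section

/-- The `q`-derivative `(D_{q,x} f)(x) = (f x - f (q x)) / (x - q x)`; used only for `x ≠ 0`, `q ≠ 1`. -/
def qDeriv (q : ℝ) (f : ℝ → ℝ) (x : ℝ) : ℝ :=
  (f x - f (q * x)) / (x - q * x)

/-- The `q`-integer `[n]_q = 1 + q + ... + q ^ (n - 1)`, with `[0]_q = 0`. -/
def qInt (q : ℝ) (n : ℕ) : ℝ :=
  ∑ i ∈ Finset.range n, q ^ i

/-- The open interval `(A, B)` of real numbers; the end-points may be infinite. -/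
def openInterval (A B : EReal) : Set ℝ :=
  {m : ℝ | A < (m : EReal) ∧ (m : EReal) < B}

/-- The measures `w(m, u) μ(du)`, `m ∈ (A, B)`, form a `q`-exponential family with variance
function `V`. The density `w` matters only for `m ∈ (A, B)` and `u` in the (closed) support
of `μ`. The `q`-differential equation at `m` involves the density at `m` and at `q m`, so it is
required exactly when both points belong to `(A, B)`; for `0 ≤ q < 1` this is every `m`. -/
structure IsQExponentialFamily (q : ℝ) (V : ℝ → ℝ) (A B : EReal) (μ : Measure ℝ)
    (w : ℝ → ℝ → ℝ) : Prop where
  /-- The densities are measurable and non-negative almost everywhere. -/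
  aemeasurable : ∀ m ∈ openInterval A B, AEMeasurable (w m) μ
  nonneg : ∀ m ∈ openInterval A B, ∀ᵐ u ∂μ, 0 ≤ w m u
  /-- Each `w(m, u) μ(du)` is a probability measure. -/
  isProbabilityMeasure : ∀ m ∈ openInterval A B,
    IsProbabilityMeasure (μ.withDensity fun u => ENNReal.ofReal (w m u))
  /-- `μ` is compactly supported. -/
  isCompact_support : IsCompact μ.support
  zero_mem : (0 : ℝ) ∈ openInterval A B
  /-- `lim_{t → 0} w(t, u) = w(0, u) = 1` on the support. -/
  at_zero : ∀ u ∈ μ.support, w 0 u = 1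
  tendsto_zero : ∀ u ∈ μ.support, Tendsto (fun t => w t u) (𝓝 0) (𝓝 1)
  V_pos : ∀ m ∈ openInterval A B, 0 < V m
  /-- The `q`-differential equation `D_{q,m} w(m, u) = w(m, u) (u - m) / V(m)`. -/
  qDeriv_eq : ∀ m ∈ openInterval A B, m ≠ 0 → q * m ∈ openInterval A B → ∀ u ∈ μ.support,
    qDeriv q (fun t => w t u) m = w m u * ((u - m) / V m)

/-- The monic Al-Salam-Chihara polynomials given by `p₋₁ = 0`, `p₀ = 1` and
`u pₙ(u) = pₙ₊₁(u) + a [n]_q pₙ(u) + (1 + b [n-1]_q) [n]_q pₙ₋₁(u)`. -/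
def alSalamChihara (q a b : ℝ) : ℕ → Polynomial ℝ
  | 0 => 1
  | 1 => Polynomial.X
  | n + 2 =>
      (Polynomial.X - Polynomial.C (a * qInt q (n + 1))) * alSalamChihara q a b (n + 1)
        - Polynomial.C ((1 + b * qInt q n) * qInt q (n + 1)) * alSalamChihara q a b n

/-- `μ` is an orthogonality measure of the sequence of polynomials `p`. -/
structure IsOrthogonalityMeasure (μ : Measure ℝ) (p : ℕ → Polynomial ℝ) : Prop where
  /-- All moments of `μ` are finite. -/
  integrable : ∀ P : Polynomial ℝ, Integrable (fun u => P.eval u) μ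
  orthogonal : ∀ m n : ℕ, m ≠ n → ∫ u, (p m).eval u * (p n).eval u ∂μ = 0
  norm_pos : ∀ n : ℕ, 0 < ∫ u, (p n).eval u ^ 2 ∂μ

/-- The absolutely continuous part, with respect to Lebesgue measure, in the Lebesgue
decomposition of `μ`. -/
def acPart (μ : Measure ℝ) : Measure ℝ :=
  (volume : Measure ℝ).withDensity (μ.rnDeriv volume)

end

/-!
The `q`-differential equation says `w(q m, u) V(m) = w(m, u) D(m, u)` with
`D(m, u) = 1 + (a - (1 - q) u) m + (b + 1 - q) m²`. Iterating it along `m, q m, q² m, …`, where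
`w` tends to `1`, shows that no denominator vanishes and gives the product formula
(`IsQExponentialFamily.den_ne_zero`, `IsQExponentialFamily.hasProd`).

The generating function `∑ pₙ(u) mⁿ / [n]_q!` of the Al-Salam-Chihara polynomials satisfies the same
equation, so for small `m` it is `w(m, u)` (`IsQExponentialFamily.exists_eq_tsum`). Integrating
`∫ w(m, u) μ(du) = 1` term by term gives `∫ pₙ dμ = 0` for `n ≥ 1`. Favard's argument turns this into
orthogonality, and since the `pₙ` span all polynomials and `μ` has compact support, the moments,
hence `μ`, are determined (`IsASCGenerator.isOrthogonalityMeasure`, `eq_of_moments_eq`).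

Everything else is read off the normalised polynomials `gₙ = pₙ / ([n]_q! sⁿ)`, `s = √(b + 1 - q)`,
whose norms converge to a positive limit and whose recurrence is a geometrically small perturbation
of `gₙ₊₁ = y gₙ - gₙ₋₁`, where `y = ((1 - q) u - a) / s` maps the interval of the theorem to `(-2, 2)`.

* *Atoms, and the exterior of the interval.* Let `z` be a root of `1 - y z + z²` with `|z| ≤ 1`, a
  potential pole of the generating function. If `gₙ zⁿ → 0` there is no pole, so the numerator
  `∏ V(qᵏ z / s)` must vanish at `z` (`QChebyshevRec.exists_numerator_eq_zero`). At an atom, Bessel's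
  inequality gives `gₙ → 0`; but for `a² < 4 b` all zeros of the numerator lie outside the unit disc.
  At `μ`-almost every point `gₙ = O(n)`, so outside the interval, where `|z| < 1`, almost every `u`
  lies in the countable set on which the numerator does vanish.
* *The interior.* On compact subsets the `gₙ` are uniformly bounded
  (`QChebyshevRec.exists_sq_le`), while `gₙ² μ` converges weakly to a multiple of the arcsine law
  (`IsASCGenerator.tendsto_integral_polynomial`). Hence `μ` dominates there a positive multiple of
  Lebesgue measure, and so does its absolutely continuous part.
-/

/-! ### The normalised three-term recurrence and its generating function -/

/-- The recurrence satisfied by the values `g n = pₙ(u) / ([n]_q! sⁿ)` of the normalised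
Al-Salam-Chihara polynomials at a point `u`, where `s ^ 2 = b + 1 - q`, `α = a / s`, `β = b / s ^ 2`
and `y = ((1 - q) u - a) / s`. As `n → ∞` it degenerates to the recurrence
`g (n + 2) = y g (n + 1) - g n` of the Chebyshev polynomials. -/
structure QChebyshevRec {𝕜 : Type*} [Field 𝕜] (q α β y : 𝕜) (g : ℕ → 𝕜) : Prop where
  zero : g 0 = 1
  one : (1 - q) * g 1 = y + α
  add_two : ∀ n, (1 - q ^ (n + 2)) * g (n + 2) =
    (y + α * q ^ (n + 1)) * g (n + 1) - (1 - β * q ^ n) * g n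

namespace QChebyshevRec

section Field

variable {𝕜 : Type*} [Field 𝕜] {q α β y : 𝕜} {g : ℕ → 𝕜}

/-- The truncated form of the functional equation
`(1 - y z + z²) G(z) = (1 + α z + β z²) G(q z)` of `G(z) = ∑ gₙ zⁿ`. -/
lemma partial_sum_identity (h : QChebyshevRec q α β y g) (z : 𝕜) (M : ℕ) :
    (1 - y * z + z ^ 2) * ∑ n ∈ Finset.range (M + 1), g n * z ^ n -
      (1 + α * z + β * z ^ 2) * ∑ n ∈ Finset.range (M + 1), g n * (q * z) ^ n =
    -((1 - q ^ (M + 1)) * (g (M + 1) * z ^ (M + 1))) +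
      (1 - β * q ^ M) * z ^ 2 * (g M * z ^ M) := by
  induction M with
  | zero =>
    have h1 := h.one
    simp [h.zero]
    linear_combination z * h1
  | succ M ih =>
    rw [Finset.sum_range_succ, Finset.sum_range_succ _ (M + 1)]
    have h2 := h.add_two M
    linear_combination ih + z ^ (M + 2) * h2

lemma map {𝕂 : Type*} [Field 𝕂] (f : 𝕜 →+* 𝕂) (h : QChebyshevRec q α β y g) :
    QChebyshevRec (f q) (f α) (f β) (f y) (fun n => f (g n)) where
  zero := by simp [h.zero]
  one := by simpa using congrArg f h.one
  add_two n := by simpa using congrArg f (h.add_two n)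

end Field

section Normed

variable {𝕜 : Type*} [NormedField 𝕜] {q α β y : 𝕜} {g : ℕ → 𝕜}

lemma tendsto_partial_sum (h : QChebyshevRec q α β y g) (hq : ‖q‖ < 1) {z : 𝕜}
    (hg : Tendsto (fun n => g n * z ^ n) atTop (𝓝 0)) :
    Tendsto (fun M => (1 - y * z + z ^ 2) * ∑ n ∈ Finset.range (M + 1), g n * z ^ n -
      (1 + α * z + β * z ^ 2) * ∑ n ∈ Finset.range (M + 1), g n * (q * z) ^ n) atTop (𝓝 0) := by
  simp_rw [h.partial_sum_identity]
  have hp : Tendsto (fun n : ℕ => q ^ n) atTop (𝓝 0) := tendsto_pow_atTop_nhds_zero_of_norm_lt_one hq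
  have h1 := (((tendsto_add_atTop_iff_nat 1).2 hp).const_sub 1).mul
    ((tendsto_add_atTop_iff_nat 1).2 hg)
  have h2 := (((hp.const_mul β).const_sub 1).mul_const (z ^ 2)).mul hg
  simpa using h1.neg.add h2

lemma summable_norm_mul_pow (hq : ‖q‖ < 1) {z : 𝕜}
    (hg : Tendsto (fun n => g n * z ^ n) atTop (𝓝 0)) (k : ℕ) :
    Summable (fun n => ‖g n * (q ^ (k + 1) * z) ^ n‖) := by
  obtain ⟨C, hC⟩ := (hg.norm).bddAbove_range
  have hC' : ∀ n, ‖g n * z ^ n‖ ≤ C := fun n => hC ⟨n, rfl⟩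
  refine Summable.of_nonneg_of_le (fun _ => norm_nonneg _) (fun n => ?_)
    ((summable_geometric_of_lt_one (norm_nonneg q) hq).mul_left C)
  have : g n * (q ^ (k + 1) * z) ^ n = (g n * z ^ n) * q ^ n * (q ^ n) ^ k := by ring
  rw [this, norm_mul, norm_mul, norm_pow, norm_pow, norm_pow]
  have hp : ‖q‖ ^ n ≤ 1 := pow_le_one₀ (norm_nonneg _) hq.le
  have hp' : (‖q‖ ^ n) ^ k ≤ 1 := pow_le_one₀ (by positivity) hp
  calc ‖g n * z ^ n‖ * ‖q‖ ^ n * (‖q‖ ^ n) ^ k ≤ ‖g n * z ^ n‖ * ‖q‖ ^ n * 1 := by gcongr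
    _ ≤ C * ‖q‖ ^ n := by rw [mul_one]; gcongr; exact hC' n

variable [CompleteSpace 𝕜]

/-- The `q`-difference equation of the generating function. -/
lemma functional_equation (h : QChebyshevRec q α β y g) (hq : ‖q‖ < 1) {z : 𝕜}
    (hg : Summable (fun n => g n * z ^ n)) :
    (1 - y * z + z ^ 2) * ∑' n, g n * z ^ n =
      (1 + α * z + β * z ^ 2) * ∑' n, g n * (q * z) ^ n := by
  have h0 := hg.tendsto_atTop_zero
  have h1 : Summable (fun n => g n * (q * z) ^ n) := by
    simpa using (summable_norm_mul_pow hq h0 0).of_norm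
  have h2 := ((tendsto_add_atTop_iff_nat 1).2 hg.hasSum.tendsto_sum_nat).const_mul
    (1 - y * z + z ^ 2)
  have h3 := ((tendsto_add_atTop_iff_nat 1).2 h1.hasSum.tendsto_sum_nat).const_mul
    (1 + α * z + β * z ^ 2)
  exact sub_eq_zero.1 (tendsto_nhds_unique (h2.sub h3) (h.tendsto_partial_sum hq h0))

lemma tendsto_tsum_one (h0 : g 0 = 1) (hq : ‖q‖ < 1) {z : 𝕜}
    (hg : Summable (fun n => ‖g n * z ^ n‖)) :
    Tendsto (fun k : ℕ => ∑' n, g n * (q ^ k * z) ^ n) atTop (𝓝 1) := by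
  have hs : ∑' n, (if n = 0 then (1 : 𝕜) else 0) = 1 := by simp
  rw [← hs]
  refine tendsto_tsum_of_dominated_convergence hg (fun n => ?_) (Eventually.of_forall fun k n => ?_)
  · rcases Nat.eq_zero_or_pos n with rfl | hn
    · simp [h0]
    · have hp : Tendsto (fun k : ℕ => q ^ k) atTop (𝓝 0) :=
        tendsto_pow_atTop_nhds_zero_of_norm_lt_one hq
      have := ((hp.mul_const z).pow n).const_mul (g n)
      simpa [hn.ne'] using this
  · rw [mul_pow, norm_mul, norm_mul, norm_mul]
    have hp : ‖(q ^ k) ^ n‖ ≤ 1 := by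
      rw [norm_pow, norm_pow]
      exact pow_le_one₀ (by positivity) (pow_le_one₀ (norm_nonneg _) hq.le)
    calc ‖g n‖ * (‖(q ^ k) ^ n‖ * ‖z ^ n‖) ≤ ‖g n‖ * (1 * ‖z ^ n‖) := by gcongr
      _ = _ := by ring

/-- If `z` is a root of `1 - y z + z²` and `gₙ zⁿ → 0`, the generating function has no pole at `z`,
so the factor `1 / (1 - y z + z²)` must be cancelled by the numerator of the infinite product:
`1 + α x + β x²` vanishes at some `x = q ^ k z`. Otherwise the functional equation would propagate
the zero `G (q z) = 0` along `q ^ k z → 0`, against `G 0 = 1`. -/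
lemma exists_numerator_eq_zero (h : QChebyshevRec q α β y g) (hq : ‖q‖ < 1) {z : 𝕜}
    (hz : 1 - y * z + z ^ 2 = 0) (hg : Tendsto (fun n => g n * z ^ n) atTop (𝓝 0)) :
    ∃ k : ℕ, 1 + α * (q ^ k * z) + β * (q ^ k * z) ^ 2 = 0 := by
  by_contra! hV
  have hsum := fun k => (summable_norm_mul_pow hq hg k).of_norm
  have hzero : ∀ k : ℕ, ∑' n, g n * (q ^ (k + 1) * z) ^ n = 0 := by
    intro k
    induction k with
    | zero =>
      have h1 := h.tendsto_partial_sum hq hg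
      have h2 : Summable (fun n => g n * (q * z) ^ n) := by simpa using hsum 0
      have h3 := ((tendsto_add_atTop_iff_nat 1).2 h2.hasSum.tendsto_sum_nat).const_mul
        (1 + α * z + β * z ^ 2)
      simp only [hz, zero_mul, zero_sub] at h1
      have h4 := tendsto_nhds_unique h3.neg h1
      have h5 := hV 0
      simp only [pow_zero, one_mul] at h5
      simpa [h5] using h4
    | succ k ih =>
      have h1 := h.functional_equation hq (hsum k)
      rw [ih, mul_zero, ← mul_assoc q, ← pow_succ'] at h1
      exact (mul_eq_zero.1 h1.symm).resolve_left (hV (k + 1))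
  have hlim := tendsto_tsum_one h.zero hq (summable_norm_mul_pow hq hg 0)
  have hconst : (fun k : ℕ => ∑' n, g n * (q ^ k * (q ^ (0 + 1) * z)) ^ n) = fun _ => 0 := by
    funext k
    rw [← hzero k]
    congr! 3 with n
    ring
  rw [hconst] at hlim
  exact one_ne_zero (tendsto_nhds_unique hlim tendsto_const_nhds)

end Normed

section Real

lemma one_sub_abs_le_abs_one_sub_pow {q : ℝ} (hq : |q| < 1) (k : ℕ) :
    1 - |q| ≤ |1 - q ^ (k + 1)| := by
  have h1 : |q ^ (k + 1)| ≤ |q| := by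
    rw [abs_pow]; exact pow_le_of_le_one (abs_nonneg q) hq.le (Nat.succ_ne_zero k)
  have h2 := le_abs_self (1 - q ^ (k + 1))
  have h3 := le_abs_self (q ^ (k + 1))
  linarith

variable {q α β y : ℝ} {g : ℕ → ℝ}

/-- A crude geometric bound, uniform in `y`. -/
lemma abs_le_pow (h : QChebyshevRec q α β y g) (hq : |q| < 1) {Y : ℝ} (hy : |y| ≤ Y) (n : ℕ) :
    |g n| ≤ (1 + (Y + |α| + 1 + |β|) / (1 - |q|)) ^ n := by
  set K := 1 + (Y + |α| + 1 + |β|) / (1 - |q|) with hK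
  have hY : 0 ≤ Y := (abs_nonneg y).trans hy
  have hq' : 0 < 1 - |q| := by linarith
  have hK1 : 1 ≤ K := by
    have : 0 ≤ (Y + |α| + 1 + |β|) / (1 - |q|) := by positivity
    linarith
  have hKq : Y + |α| + 1 + |β| ≤ K * (1 - |q|) := by
    rw [hK, add_mul, div_mul_cancel₀ _ hq'.ne']; linarith
  have hpow : ∀ k : ℕ, |q ^ k| ≤ 1 := fun k => by
    rw [abs_pow]; exact pow_le_one₀ (abs_nonneg _) hq.le
  have hden : ∀ k : ℕ, 1 - |q| ≤ |1 - q ^ (k + 1)| := one_sub_abs_le_abs_one_sub_pow hq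
  have key : ∀ n, |g n| ≤ K ^ n ∧ |g (n + 1)| ≤ K ^ (n + 1) := by
    intro n
    induction n with
    | zero =>
      refine ⟨by simp [h.zero], ?_⟩
      have h1 := congrArg abs h.one
      rw [abs_mul] at h1
      have h2 := hden 0
      simp only [zero_add, pow_one] at h2 ⊢
      have h3 := abs_add_le y α
      have h4 : (1 - |q|) * |g 1| ≤ (1 - |q|) * K := by
        have := mul_le_mul_of_nonneg_right h2 (abs_nonneg (g 1))
        have := abs_nonneg β
        linarith
      exact le_of_mul_le_mul_left h4 hq'
    | succ n ih =>
      refine ⟨ih.2, ?_⟩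
      have h1 := congrArg abs (h.add_two n)
      rw [abs_mul] at h1
      have h2 := mul_le_mul_of_nonneg_right (hden (n + 1)) (abs_nonneg (g (n + 2)))
      have h3 : |(y + α * q ^ (n + 1)) * g (n + 1) - (1 - β * q ^ n) * g n| ≤
          (Y + |α|) * K ^ (n + 1) + (1 + |β|) * K ^ n := by
        refine (abs_sub _ _).trans ?_
        rw [abs_mul, abs_mul]
        have e1 : |y + α * q ^ (n + 1)| ≤ Y + |α| := by
          refine (abs_add_le _ _).trans (add_le_add hy ?_)
          rw [abs_mul]; exact mul_le_of_le_one_right (abs_nonneg _) (hpow _)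
        have e2 : |1 - β * q ^ n| ≤ 1 + |β| := by
          refine (abs_sub _ _).trans ?_
          rw [abs_one, abs_mul]
          exact add_le_add le_rfl (mul_le_of_le_one_right (abs_nonneg _) (hpow _))
        exact add_le_add (mul_le_mul e1 ih.2 (abs_nonneg _) (by positivity))
          (mul_le_mul e2 ih.1 (abs_nonneg _) (by positivity))
      have h4 : K ^ n ≤ K ^ (n + 1) := pow_le_pow_right₀ hK1 (Nat.le_succ n)
      have h5 : (1 + |β|) * K ^ n ≤ (1 + |β|) * K ^ (n + 1) := by gcongr
      have h6 : (1 - |q|) * |g (n + 2)| ≤ (1 - |q|) * K ^ (n + 2) := by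
        have h7 : (Y + |α| + 1 + |β|) * K ^ (n + 1) ≤ K * (1 - |q|) * K ^ (n + 1) := by gcongr
        have h8 : (1 - |q|) * K ^ (n + 2) = K * (1 - |q|) * K ^ (n + 1) := by ring
        rw [h8]
        have e : n + 1 + 1 = n + 2 := rfl
        rw [e] at h2
        linarith
      exact le_of_mul_le_mul_left h6 hq'
  exact (key n).1

end Real

end QChebyshevRec

/-! ### Normalised Al-Salam-Chihara polynomials -/

/-- The `q`-factorial `[n]_q! = [1]_q [2]_q ⋯ [n]_q`. -/
def qFactorial (q : ℝ) (n : ℕ) : ℝ :=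
  ∏ i ∈ Finset.range n, qInt q (i + 1)

/-- The Al-Salam-Chihara polynomials divided by `[n]_q! sⁿ`, where `s = √(b + 1 - q)`. With this
normalisation they satisfy `QChebyshevRec`, and their squared norms converge to a positive limit. -/
noncomputable def ascNormalized (q a b : ℝ) (n : ℕ) (u : ℝ) : ℝ :=
  (alSalamChihara q a b n).eval u / (qFactorial q n * √(b + 1 - q) ^ n)

/-- The affine change of variable that takes the interval between
`a / (1 - q) ± 2 √(b + 1 - q) / (1 - q)` to `(-2, 2)`. -/
noncomputable def ascVariable (q a b u : ℝ) : ℝ :=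
  ((1 - q) * u - a) / √(b + 1 - q)

lemma one_sub_mul_qInt (q : ℝ) (n : ℕ) : (1 - q) * qInt q n = 1 - q ^ n :=
  mul_neg_geom_sum q n

lemma qInt_succ_pos {q : ℝ} (hq : |q| < 1) (n : ℕ) : 0 < qInt q (n + 1) := by
  have h1 : 0 < 1 - q := by linarith [(abs_lt.1 hq).2]
  have h2 : q ^ (n + 1) < 1 := by
    refine (le_abs_self _).trans_lt ?_
    rw [abs_pow]
    exact pow_lt_one₀ (abs_nonneg q) hq (Nat.succ_ne_zero n)
  have h3 := one_sub_mul_qInt q (n + 1)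
  exact pos_of_mul_pos_right (by rw [h3]; linarith) h1.le

lemma qFactorial_pos {q : ℝ} (hq : |q| < 1) (n : ℕ) : 0 < qFactorial q n :=
  Finset.prod_pos fun i _ => qInt_succ_pos hq i

lemma qFactorial_succ (q : ℝ) (n : ℕ) : qFactorial q (n + 1) = qFactorial q n * qInt q (n + 1) :=
  Finset.prod_range_succ _ n

lemma add_one_sub_pos {q b : ℝ} (hb : -1 + max q 0 < b) : 0 < b + 1 - q := by
  have := le_max_left q 0
  linarith

lemma scale_pos {q b : ℝ} (hb : -1 + max q 0 < b) : 0 < √(b + 1 - q) :=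
  Real.sqrt_pos.2 (add_one_sub_pos hb)

lemma scale_sq {q b : ℝ} (hb : -1 + max q 0 < b) : √(b + 1 - q) ^ 2 = b + 1 - q :=
  Real.sq_sqrt (add_one_sub_pos hb).le

/-- The hypothesis on `b` says precisely that the recurrence coefficients are positive. -/
lemma mul_pow_lt {q b : ℝ} (hq : |q| < 1) (hb : -1 + max q 0 < b) (n : ℕ) :
    b * q ^ n < b + 1 - q := by
  obtain ⟨h1, h2⟩ := abs_lt.1 hq
  have hp := abs_le.1 ((abs_pow q n).trans_le (pow_le_one₀ (abs_nonneg q) hq.le))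
  have hl := le_max_left q 0
  have hr := le_max_right q 0
  rcases le_or_gt 0 b with hb0 | hb0
  · nlinarith
  rcases le_or_gt 0 q with hq0 | hq0
  · have := mul_nonneg (neg_nonneg.2 hb0.le) (sub_nonneg.2 hp.2)
    have := pow_nonneg hq0 n
    nlinarith
  · -- for negative `q` and `b` the extreme case is `n = 1`
    have hqn : q ≤ q ^ n := by
      rcases Nat.eq_zero_or_pos n with rfl | hn
      · simpa using h2.le
      · have h3 : |q ^ n| ≤ |q| := by
          rw [abs_pow]; exact pow_le_of_le_one (abs_nonneg q) hq.le hn.ne'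
        rw [abs_of_neg hq0] at h3
        linarith [neg_abs_le (q ^ n)]
    nlinarith

lemma alSalamChihara_eval_add_two (q a b u : ℝ) (n : ℕ) :
    (alSalamChihara q a b (n + 2)).eval u =
      (u - a * qInt q (n + 1)) * (alSalamChihara q a b (n + 1)).eval u -
        (1 + b * qInt q n) * qInt q (n + 1) * (alSalamChihara q a b n).eval u := by
  simp [alSalamChihara]

lemma eval_eq_mul_ascNormalized {q b : ℝ} (hq : |q| < 1) (hb : -1 + max q 0 < b) (a u : ℝ) (n : ℕ) :
    (alSalamChihara q a b n).eval u =
      (qFactorial q n * √(b + 1 - q) ^ n) * ascNormalized q a b n u := by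
  have h1 := (qFactorial_pos hq n).ne'
  have h2 := (pow_pos (scale_pos hb) n).ne'
  rw [ascNormalized, mul_div_cancel₀ _ (mul_ne_zero h1 h2)]

lemma ascNormalized_rec {q b : ℝ} (hq : |q| < 1) (hb : -1 + max q 0 < b) (a u : ℝ) :
    QChebyshevRec q (a / √(b + 1 - q)) (b / √(b + 1 - q) ^ 2) (ascVariable q a b u)
      (fun n => ascNormalized q a b n u) where
  zero := by simp [ascNormalized, alSalamChihara, qFactorial]
  one := by
    have hs := (scale_pos hb).ne'
    simp [ascNormalized, alSalamChihara, qFactorial, ascVariable, qInt]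
    field_simp
    ring
  add_two n := by
    have hs := scale_pos hb
    have hs2 := scale_sq hb
    have hp0 := eval_eq_mul_ascNormalized hq hb a u n
    have hp1 := eval_eq_mul_ascNormalized hq hb a u (n + 1)
    have hp2 := eval_eq_mul_ascNormalized hq hb a u (n + 2)
    have hr := alSalamChihara_eval_add_two q a b u n
    rw [hp0, hp1, hp2, qFactorial_succ, qFactorial_succ] at hr
    have hF := qFactorial_pos hq n
    have hc := qInt_succ_pos hq n
    have e0 := one_sub_mul_qInt q n
    have e1 := one_sub_mul_qInt q (n + 1)
    have e2 := one_sub_mul_qInt q (n + 2)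
    rw [ascVariable]
    set s := √(b + 1 - q)
    set g0 := ascNormalized q a b n u
    set g1 := ascNormalized q a b (n + 1) u
    set g2 := ascNormalized q a b (n + 2) u
    have hmain : qInt q (n + 2) * s ^ 2 * g2 =
        (u - a * qInt q (n + 1)) * s * g1 - (1 + b * qInt q n) * g0 := by
      refine mul_left_cancel₀ (mul_pos (mul_pos hF hc) (pow_pos hs n)).ne' ?_
      linear_combination hr
    refine mul_left_cancel₀ (pow_pos hs 2).ne' ?_
    field_simp
    linear_combination (1 - q) * hmain - s ^ 2 * g2 * e2 - a * s * g1 * e1 - b * g0 * e0 + g0 * hs2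

lemma continuous_ascNormalized (q a b : ℝ) (n : ℕ) : Continuous (ascNormalized q a b n) :=
  (Polynomial.continuous _).div_const _

/-! ### The density of a `q`-exponential family -/

lemma mul_mem_openInterval {A B : EReal} {m t : ℝ} (h0 : (0 : ℝ) ∈ openInterval A B)
    (hm : m ∈ openInterval A B) (ht0 : 0 ≤ t) (ht1 : t ≤ 1) : t * m ∈ openInterval A B := by
  rcases le_total 0 m with h | h
  · exact ⟨h0.1.trans_le (EReal.coe_le_coe_iff.2 (by positivity)),
      (EReal.coe_le_coe_iff.2 (mul_le_of_le_one_left h ht1)).trans_lt hm.2⟩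
  · exact ⟨hm.1.trans_le (EReal.coe_le_coe_iff.2 (by nlinarith)),
      (EReal.coe_le_coe_iff.2 (mul_nonpos_of_nonneg_of_nonpos ht0 h)).trans_lt h0.2⟩

lemma pow_mul_mem_openInterval {A B : EReal} {q m : ℝ} (hq : |q| < 1)
    (h0 : (0 : ℝ) ∈ openInterval A B) (hm : m ∈ openInterval A B) (hqm : q * m ∈ openInterval A B)
    (k : ℕ) : q ^ k * m ∈ openInterval A B := by
  have key : ∀ k : ℕ, q ^ k * m ∈ openInterval A B ∧ q ^ (k + 1) * m ∈ openInterval A B := by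
    intro k
    induction k with
    | zero => exact ⟨by simpa using hm, by simpa using hqm⟩
    | succ k ih =>
      refine ⟨ih.2, ?_⟩
      have h2 := mul_mem_openInterval h0 ih.1 (sq_nonneg q) ((sq_le_one_iff_abs_le_one q).2 hq.le)
      rwa [← mul_assoc, ← pow_add, add_comm 2 k] at h2
  exact (key k).1

lemma isOpen_openInterval (A B : EReal) : IsOpen (openInterval A B) :=
  isOpen_Ioo.preimage continuous_coe_real_ereal

/-- Solutions of a first-order linear recurrence that tend to `1` agree. -/
lemma eq_of_linear_recurrence {f w V D : ℕ → ℝ} (hf : ∀ k, f (k + 1) * V k = f k * D k)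
    (hw : ∀ k, w (k + 1) * V k = w k * D k) (hV : ∀ k, V k ≠ 0)
    (hf1 : Tendsto f atTop (𝓝 1)) (hw1 : Tendsto w atTop (𝓝 1)) : f 0 = w 0 := by
  have h : ∀ n, f 0 * w n = w 0 * f n := by
    intro n
    induction n with
    | zero => ring
    | succ n ih =>
      refine mul_right_cancel₀ (hV n) ?_
      linear_combination f 0 * hw n - w 0 * hf n + D n * ih
  have h1 := hw1.const_mul (f 0)
  have h2 := hf1.const_mul (w 0)
  simp_rw [← h] at h2
  simpa using tendsto_nhds_unique h1 h2

namespace IsQExponentialFamily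

variable {q a b : ℝ} {A B : EReal} {μ : Measure ℝ} {w : ℝ → ℝ → ℝ}

/-- The `q`-differential equation, cleared of denominators. -/
lemma step (hF : IsQExponentialFamily q (fun m => 1 + a * m + b * m ^ 2) A B μ w) (hq : |q| < 1)
    {m u : ℝ} (hm : m ∈ openInterval A B) (hqm : q * m ∈ openInterval A B) (hu : u ∈ μ.support) :
    w (q * m) u * (1 + a * m + b * m ^ 2) =
      w m u * (1 + (a - (1 - q) * u) * m + (b + 1 - q) * m ^ 2) := by
  rcases eq_or_ne m 0 with rfl | h0
  · simp
  have h1 := hF.qDeriv_eq m hm h0 hqm u hu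
  have hV := hF.V_pos m hm
  have hq1 : 1 - q ≠ 0 := by linarith [(abs_lt.1 hq).2]
  have hd : m - q * m ≠ 0 := by
    have : m - q * m = (1 - q) * m := by ring
    rw [this]; exact mul_ne_zero hq1 h0
  simp only [qDeriv] at h1 hV
  rw [← mul_div_assoc, div_eq_div_iff hd hV.ne'] at h1
  linear_combination -h1

lemma tendsto_along_pow (hF : IsQExponentialFamily q (fun m => 1 + a * m + b * m ^ 2) A B μ w)
    (hq : |q| < 1) (m : ℝ) {u : ℝ} (hu : u ∈ μ.support) :
    Tendsto (fun k : ℕ => w (q ^ k * m) u) atTop (𝓝 1) := by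
  have hp : Tendsto (fun k : ℕ => q ^ k) atTop (𝓝 0) := tendsto_pow_atTop_nhds_zero_of_abs_lt_one hq
  refine (hF.tendsto_zero u hu).comp ?_
  simpa using hp.mul_const m

lemma den_ne_zero (hF : IsQExponentialFamily q (fun m => 1 + a * m + b * m ^ 2) A B μ w)
    (hq : |q| < 1) {m u : ℝ} (hm : m ∈ openInterval A B) (hqm : q * m ∈ openInterval A B)
    (hu : u ∈ μ.support) (k : ℕ) :
    1 + (a - (1 - q) * u) * (q ^ k * m) + (b + 1 - q) * (q ^ k * m) ^ 2 ≠ 0 := by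
  intro h0
  have hmem := pow_mul_mem_openInterval hq hF.zero_mem hm hqm
  have hstep := fun j => hF.step hq (hmem j) (by rw [← mul_assoc, ← pow_succ']; exact hmem (j + 1)) hu
  simp_rw [← mul_assoc, ← pow_succ'] at hstep
  -- a vanishing denominator would make the density vanish at all later points `q ^ j m`
  have hz : ∀ j, w (q ^ (j + (k + 1)) * m) u = 0 := by
    intro j
    induction j with
    | zero =>
      have h1 := hstep k
      simp only [← mul_assoc] at h0
      rw [h0, mul_zero] at h1
      simpa using (mul_eq_zero.1 h1).resolve_right (by
        have := hF.V_pos _ (hmem k); simp only [← mul_assoc] at this; exact this.ne')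
    | succ j ih =>
      have h1 := hstep (j + (k + 1))
      rw [ih, zero_mul] at h1
      have h2 := (mul_eq_zero.1 h1).resolve_right (by
        have := hF.V_pos _ (hmem (j + (k + 1))); simp only [← mul_assoc] at this; exact this.ne')
      rwa [show j + 1 + (k + 1) = j + (k + 1) + 1 by ring]
  have hlim := (tendsto_add_atTop_iff_nat (k + 1)).2 (hF.tendsto_along_pow hq m hu)
  simp_rw [hz] at hlim
  exact zero_ne_one (tendsto_nhds_unique tendsto_const_nhds hlim)

lemma hasProd (hF : IsQExponentialFamily q (fun m => 1 + a * m + b * m ^ 2) A B μ w)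
    (hq : |q| < 1) {m u : ℝ} (hm : m ∈ openInterval A B) (hqm : q * m ∈ openInterval A B)
    (hu : u ∈ μ.support) :
    HasProd (fun k : ℕ => (1 + a * (q ^ k * m) + b * (q ^ k * m) ^ 2) /
      (1 + (a - (1 - q) * u) * (q ^ k * m) + (b + 1 - q) * (q ^ k * m) ^ 2)) (w m u) := by
  have hmem := pow_mul_mem_openInterval hq hF.zero_mem hm hqm
  have hD := hF.den_ne_zero hq hm hqm hu
  set V : ℕ → ℝ := fun k => 1 + a * (q ^ k * m) + b * (q ^ k * m) ^ 2 with hVdef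
  set D : ℕ → ℝ := fun k => 1 + (a - (1 - q) * u) * (q ^ k * m) + (b + 1 - q) * (q ^ k * m) ^ 2
    with hDdef
  have hD' : ∀ k, D k ≠ 0 := hD
  have hstep : ∀ k, w (q ^ (k + 1) * m) u * V k = w (q ^ k * m) u * D k := fun k => by
    have := hF.step hq (hmem k) (by rw [← mul_assoc, ← pow_succ']; exact hmem (k + 1)) hu
    rwa [← mul_assoc q, ← pow_succ'] at this
  have hpart : ∀ n, (∏ k ∈ Finset.range n, V k / D k) * w (q ^ n * m) u = w m u := by
    intro n
    induction n with
    | zero => simp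
    | succ n ih =>
      rw [Finset.prod_range_succ, ← ih]
      have h1 : V n / D n * w (q ^ (n + 1) * m) u = w (q ^ n * m) u := by
        rw [div_mul_eq_mul_div, div_eq_iff (hD' n)]; linarith [hstep n]
      rw [mul_assoc, h1]
  have hp : Tendsto (fun k : ℕ => q ^ k) atTop (𝓝 0) := tendsto_pow_atTop_nhds_zero_of_abs_lt_one hq
  have hpm : Tendsto (fun k : ℕ => q ^ k * m) atTop (𝓝 0) := by simpa using hp.mul_const m
  have hDlim : Tendsto D atTop (𝓝 1) := by
    have := ((hpm.const_mul (a - (1 - q) * u)).const_add 1).add ((hpm.pow 2).const_mul (b + 1 - q))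
    simpa [hDdef] using this
  have hmul : Multipliable (fun k => V k / D k) := by
    have hbd : Tendsto (fun k => (1 - q) * m * (u - q ^ k * m) / D k) atTop
        (𝓝 ((1 - q) * m * (u - 0) / 1)) :=
      ((hpm.const_sub u).const_mul _).div hDlim one_ne_zero
    obtain ⟨C, hC⟩ := hbd.norm.bddAbove_range
    have hsum : Summable (fun k => q ^ k * ((1 - q) * m * (u - q ^ k * m) / D k)) := by
      refine Summable.of_norm_bounded
        ((summable_geometric_of_lt_one (abs_nonneg q) hq).mul_left C) fun k => ?_
      rw [norm_mul, norm_pow, mul_comm, Real.norm_eq_abs q]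
      exact mul_le_mul_of_nonneg_right (hC ⟨k, rfl⟩) (by positivity)
    refine (Real.multipliable_one_add_of_summable hsum).congr fun k => ?_
    rw [eq_div_iff (hD' k), add_mul, mul_assoc (q ^ k), div_mul_cancel₀ _ (hD' k)]
    simp only [hVdef, hDdef]
    ring
  have hlim := hmul.hasProd.tendsto_prod_nat.mul (hF.tendsto_along_pow hq m hu)
  simp_rw [hpart] at hlim
  have h := tendsto_nhds_unique tendsto_const_nhds hlim
  rw [h, mul_one]
  exact hmul.hasProd

lemma isProbabilityMeasure_generator
    (hF : IsQExponentialFamily q (fun m => 1 + a * m + b * m ^ 2) A B μ w) :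
    IsProbabilityMeasure μ := by
  have h := hF.isProbabilityMeasure 0 hF.zero_mem
  have hw : (fun u => ENNReal.ofReal (w 0 u)) =ᵐ[μ] 1 := by
    filter_upwards [Measure.support_mem_ae] with u hu
    simp [hF.at_zero u hu]
  rwa [withDensity_congr_ae hw, withDensity_one] at h

/-- Close to `0` the density is the generating function of the normalised Al-Salam-Chihara
polynomials, uniformly in `u`: both solve the same `q`-difference equation. -/
lemma exists_eq_tsum (hF : IsQExponentialFamily q (fun m => 1 + a * m + b * m ^ 2) A B μ w)
    (hq : |q| < 1) (hb : -1 + max q 0 < b) : ∃ ρ > 0, ∀ m : ℝ, |m| < ρ → m ∈ openInterval A B ∧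
      ∀ u ∈ μ.support, (∀ n, |ascNormalized q a b n u * (√(b + 1 - q) * m) ^ n| ≤ (1 / 2) ^ n) ∧
        w m u = ∑' n, ascNormalized q a b n u * (√(b + 1 - q) * m) ^ n := by
  obtain ⟨R, hR⟩ := hF.isCompact_support.isBounded.exists_norm_le
  obtain ⟨ε, hε, hball⟩ := Metric.isOpen_iff.1 (isOpen_openInterval A B) 0 hF.zero_mem
  have hs := scale_pos hb
  have hs2 := scale_sq hb
  set s := √(b + 1 - q) with hsdef
  set Y := (|1 - q| * |R| + |a|) / s with hY
  set K := 1 + (Y + |a / s| + 1 + |b / s ^ 2|) / (1 - |q|) with hK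
  have hY0 : 0 ≤ Y := by positivity
  have hq' : 0 < 1 - |q| := by linarith
  have hKpos : 0 < K := by positivity
  have hin : ∀ m : ℝ, |m| < min ε (1 / (2 * K * s)) → m ∈ openInterval A B := fun m hm =>
    hball (by simpa using hm.trans_le (min_le_left _ _))
  refine ⟨min ε (1 / (2 * K * s)), lt_min hε (by positivity), fun m hm => ⟨hin m hm, fun u hu => ?_⟩⟩
  have hrec := ascNormalized_rec hq hb a u
  have hy : |ascVariable q a b u| ≤ Y := by
    rw [ascVariable, abs_div, abs_of_pos hs, hY]
    refine div_le_div_of_nonneg_right ((abs_sub _ _).trans ?_) hs.le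
    rw [abs_mul]
    have := (hR u hu).trans (le_abs_self R)
    rw [Real.norm_eq_abs] at this
    gcongr
  have hbound : ∀ n, |ascNormalized q a b n u * (s * m) ^ n| ≤ (1 / 2) ^ n := fun n => by
    rw [abs_mul, abs_pow, abs_mul, abs_of_pos hs]
    have h1 := hrec.abs_le_pow hq hy n
    have h2 : s * |m| ≤ 1 / (2 * K) := by
      have h3 := (hm.trans_le (min_le_right _ _)).le
      calc s * |m| ≤ s * (1 / (2 * K * s)) := by gcongr
        _ = 1 / (2 * K) := by field_simp
    calc |ascNormalized q a b n u| * (s * |m|) ^ n ≤ K ^ n * (1 / (2 * K)) ^ n := by gcongr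
      _ = (1 / 2) ^ n := by rw [← mul_pow]; congr 1; field_simp
  refine ⟨hbound, ?_⟩
  have hsum : Summable (fun n => ‖ascNormalized q a b n u * (s * m) ^ n‖) :=
    Summable.of_nonneg_of_le (fun _ => norm_nonneg _) hbound
      (summable_geometric_of_lt_one (by norm_num) (by norm_num))
  have hqm : q * m ∈ openInterval A B := hin _ (by
    rw [abs_mul]; exact (mul_le_of_le_one_left (abs_nonneg m) hq.le).trans_lt hm)
  have hmem := pow_mul_mem_openInterval hq hF.zero_mem (hin m hm) hqm
  have hstep : ∀ k : ℕ, w (q ^ (k + 1) * m) u * (1 + a * (q ^ k * m) + b * (q ^ k * m) ^ 2) =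
      w (q ^ k * m) u *
        (1 + (a - (1 - q) * u) * (q ^ k * m) + (b + 1 - q) * (q ^ k * m) ^ 2) := fun k => by
    have := hF.step hq (hmem k) (by rw [← mul_assoc, ← pow_succ']; exact hmem (k + 1)) hu
    rwa [← mul_assoc q, ← pow_succ'] at this
  have hpow : ∀ k : ℕ, Summable (fun n => ascNormalized q a b n u * (q ^ k * (s * m)) ^ n) := by
    intro k
    refine Summable.of_norm_bounded hsum fun n => ?_
    rw [norm_mul, norm_mul, mul_pow, norm_mul, norm_pow, norm_pow]
    have : (‖q‖ ^ k) ^ n ≤ 1 := pow_le_one₀ (by positivity) (pow_le_one₀ (norm_nonneg q) hq.le)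
    calc ‖ascNormalized q a b n u‖ * ((‖q‖ ^ k) ^ n * ‖(s * m) ^ n‖)
        ≤ ‖ascNormalized q a b n u‖ * (1 * ‖(s * m) ^ n‖) := by gcongr
      _ = _ := by rw [one_mul]
  have hG : ∀ k : ℕ, (∑' n, ascNormalized q a b n u * (q ^ (k + 1) * (s * m)) ^ n) *
      (1 + a * (q ^ k * m) + b * (q ^ k * m) ^ 2) =
      (∑' n, ascNormalized q a b n u * (q ^ k * (s * m)) ^ n) *
        (1 + (a - (1 - q) * u) * (q ^ k * m) + (b + 1 - q) * (q ^ k * m) ^ 2) := fun k => by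
    have h1 := hrec.functional_equation hq (hpow k)
    rw [← mul_assoc q, ← pow_succ'] at h1
    have h2 : 1 + a / s * (q ^ k * (s * m)) + b / s ^ 2 * (q ^ k * (s * m)) ^ 2 =
        1 + a * (q ^ k * m) + b * (q ^ k * m) ^ 2 := by field_simp
    have h3 : 1 - ascVariable q a b u * (q ^ k * (s * m)) + (q ^ k * (s * m)) ^ 2 =
        1 + (a - (1 - q) * u) * (q ^ k * m) + (b + 1 - q) * (q ^ k * m) ^ 2 := by
      rw [ascVariable, ← hsdef, ← hs2]
      field_simp
      ring
    rw [h2, h3] at h1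
    linarith
  have h := eq_of_linear_recurrence hstep hG (fun k => (hF.V_pos _ (hmem k)).ne')
    (hF.tendsto_along_pow hq m hu) (QChebyshevRec.tendsto_tsum_one hrec.zero hq hsum)
  simpa using h

end IsQExponentialFamily

/-! ### Compactly supported measures and their moments -/

lemma ae_abs_le_of_isCompact_support {μ : Measure ℝ} (h : IsCompact μ.support) :
    ∃ R > 0, ∀ᵐ u ∂μ, |u| ≤ R := by
  obtain ⟨R, hR0, hR⟩ := h.isBounded.exists_pos_norm_le
  refine ⟨R, hR0, ?_⟩
  filter_upwards [Measure.support_mem_ae] with u hu using hR u hu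

lemma integrable_of_continuous_of_ae_abs_le {μ : Measure ℝ} [IsFiniteMeasure μ] {R : ℝ}
    (hR : ∀ᵐ u ∂μ, |u| ≤ R) {f : ℝ → ℝ} (hf : Continuous f) : Integrable f μ := by
  obtain ⟨C, hC⟩ := (isCompact_Icc (a := -R) (b := R)).exists_bound_of_continuousOn hf.continuousOn
  refine Integrable.of_bound hf.aestronglyMeasurable C ?_
  filter_upwards [hR] with u hu using hC u (abs_le.1 hu)

lemma abs_integral_sub_integral_le {μ : Measure ℝ} [IsProbabilityMeasure μ] {R ε : ℝ}
    (hR : ∀ᵐ u ∂μ, |u| ≤ R) {f g : ℝ → ℝ} (hf : Integrable f μ) (hg : Integrable g μ)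
    (h : ∀ u ∈ Set.Icc (-R) R, |f u - g u| ≤ ε) : |∫ u, f u ∂μ - ∫ u, g u ∂μ| ≤ ε := by
  rw [← integral_sub hf hg]
  have := norm_integral_le_of_norm_le_const (μ := μ) (f := fun u => f u - g u) (C := ε)
    (by filter_upwards [hR] with u hu using h u (abs_le.1 hu))
  simpa using this

/-- A measure with the moments of a measure carried by `[-R, R]` is carried by `[-R, R]`. -/
lemma ae_abs_le_of_moments_eq {μ ν : Measure ℝ} [IsProbabilityMeasure μ] [IsProbabilityMeasure ν]
    {R : ℝ} (hR0 : 0 < R) (hR : ∀ᵐ u ∂μ, |u| ≤ R)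
    (hν : ∀ P : Polynomial ℝ, Integrable (fun u => P.eval u) ν)
    (h : ∀ P : Polynomial ℝ, ∫ u, P.eval u ∂ν = ∫ u, P.eval u ∂μ) : ∀ᵐ u ∂ν, |u| ≤ R := by
  have hmom : ∀ n : ℕ, ∫ u, u ^ (2 * n) ∂ν ≤ R ^ (2 * n) := fun n => by
    have h1 := h (Polynomial.X ^ (2 * n))
    simp only [Polynomial.eval_pow, Polynomial.eval_X] at h1
    rw [h1]
    have h2 : ∫ u, u ^ (2 * n) ∂μ ≤ ∫ _u, R ^ (2 * n) ∂μ := by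
      refine integral_mono_ae (integrable_of_continuous_of_ae_abs_le hR (by fun_prop))
        (integrable_const _) ?_
      filter_upwards [hR] with u hu
      show u ^ (2 * n) ≤ R ^ (2 * n)
      rw [pow_mul, pow_mul]
      exact pow_le_pow_left₀ (sq_nonneg u) (sq_le_sq' (abs_le.1 hu).1 (abs_le.1 hu).2) n
    simpa using h2
  have htail : ∀ k : ℕ, ν {u | (R + 1 / (k + 1)) ≤ |u|} = 0 := by
    intro k
    set R' : ℝ := R + 1 / (k + 1) with hR'
    have hRR' : R < R' := by rw [hR']; have : (0 : ℝ) < 1 / (k + 1) := by positivity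
                             linarith
    have hR'0 : 0 < R' := hR0.trans hRR'
    have hle : ∀ n : ℕ, ν.real {u | R' ≤ |u|} ≤ ((R / R') ^ 2) ^ n := fun n => by
      have hint : Integrable (fun u : ℝ => u ^ (2 * n)) ν := by
        simpa using hν (Polynomial.X ^ (2 * n))
      have h1 := mul_meas_ge_le_integral_of_nonneg (μ := ν) (f := fun u : ℝ => u ^ (2 * n))
        (Eventually.of_forall fun u => (even_two_mul n).pow_nonneg u) hint (R' ^ (2 * n))
      have h2 : ν.real {u | R' ≤ |u|} ≤ ν.real {u | R' ^ (2 * n) ≤ u ^ (2 * n)} := by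
        refine measureReal_mono (fun u hu => ?_)
        show R' ^ (2 * n) ≤ u ^ (2 * n)
        have : u ^ (2 * n) = |u| ^ (2 * n) := by rw [pow_mul, pow_mul, sq_abs]
        rw [this]
        exact pow_le_pow_left₀ hR'0.le hu _
      rw [← pow_mul, div_pow, le_div_iff₀ (by positivity), mul_comm]
      exact (mul_le_mul_of_nonneg_left h2 (by positivity)).trans (h1.trans (hmom n))
    have hlim : Tendsto (fun n : ℕ => ((R / R') ^ 2) ^ n) atTop (𝓝 0) := by
      refine tendsto_pow_atTop_nhds_zero_of_lt_one (by positivity) ?_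
      exact pow_lt_one₀ (by positivity) ((div_lt_one hR'0).2 hRR') two_ne_zero
    have h0 : ν.real {u | R' ≤ |u|} ≤ 0 := ge_of_tendsto' hlim hle
    exact (measureReal_eq_zero_iff).1 (le_antisymm h0 measureReal_nonneg)
  have hall : ∀ᵐ u ∂ν, ∀ k : ℕ, ¬ (R + 1 / (k + 1)) ≤ |u| :=
    ae_all_iff.2 fun k => by simpa [ae_iff] using htail k
  filter_upwards [hall] with u hu
  refine le_of_forall_pos_lt_add fun ε hε => ?_
  obtain ⟨k, hk⟩ := exists_nat_one_div_lt hε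
  have := not_le.1 (hu k)
  linarith

/-- A compactly supported probability measure is determined by its moments. -/
lemma eq_of_moments_eq {μ ν : Measure ℝ} [IsProbabilityMeasure μ] [IsProbabilityMeasure ν]
    (hμ : IsCompact μ.support) (hν : ∀ P : Polynomial ℝ, Integrable (fun u => P.eval u) ν)
    (h : ∀ P : Polynomial ℝ, ∫ u, P.eval u ∂ν = ∫ u, P.eval u ∂μ) : ν = μ := by
  obtain ⟨R, hR0, hR⟩ := ae_abs_le_of_isCompact_support hμ
  have hRν := ae_abs_le_of_moments_eq hR0 hR hν h
  refine ext_of_forall_integral_eq_of_IsFiniteMeasure fun f => ?_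
  refine eq_of_abs_sub_le_all fun ε hε => ?_
  obtain ⟨P, hP⟩ := exists_polynomial_near_of_continuousOn (-R) R f f.continuous.continuousOn
    (ε / 2) (half_pos hε)
  have h1 := abs_integral_sub_integral_le hRν (hν P)
    (integrable_of_continuous_of_ae_abs_le hRν f.continuous) (fun u hu => (hP u hu).le)
  have h2 := abs_integral_sub_integral_le hR
    (integrable_of_continuous_of_ae_abs_le hR (Polynomial.continuous P))
    (integrable_of_continuous_of_ae_abs_le hR f.continuous) (fun u hu => (hP u hu).le)
  rw [h] at h1
  rw [abs_le] at *
  constructor <;> linarith [h1.1, h1.2, h2.1, h2.2]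

/-! ### Orthogonality from the three-term recurrence -/

lemma X_mul_alSalamChihara (q a b : ℝ) (n : ℕ) :
    Polynomial.X * alSalamChihara q a b (n + 1) = alSalamChihara q a b (n + 2) +
      (a * qInt q (n + 1)) • alSalamChihara q a b (n + 1) +
        ((1 + b * qInt q n) * qInt q (n + 1)) • alSalamChihara q a b n := by
  simp only [alSalamChihara, Polynomial.smul_eq_C_mul]
  ring

lemma span_alSalamChihara (q a b : ℝ) :
    Submodule.span ℝ (Set.range (alSalamChihara q a b)) = ⊤ := by
  set S := Submodule.span ℝ (Set.range (alSalamChihara q a b))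
  have hp : ∀ n, alSalamChihara q a b n ∈ S := fun n => Submodule.subset_span ⟨n, rfl⟩
  have hX : ∀ P ∈ S, Polynomial.X * P ∈ S := by
    intro P hP
    induction hP using Submodule.span_induction with
    | mem P h =>
      obtain ⟨n, rfl⟩ := h
      cases n with
      | zero => simpa [alSalamChihara] using hp 1
      | succ n =>
        rw [X_mul_alSalamChihara]
        exact S.add_mem (S.add_mem (hp _) (S.smul_mem _ (hp _))) (S.smul_mem _ (hp _))
    | zero => simp
    | add P Q _ _ h1 h2 => rw [mul_add]; exact S.add_mem h1 h2
    | smul c P _ h1 => rw [mul_smul_comm]; exact S.smul_mem c h1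
  have hXn : ∀ n : ℕ, (Polynomial.X : Polynomial ℝ) ^ n ∈ S := by
    intro n
    induction n with
    | zero => simpa [alSalamChihara] using hp 0
    | succ n ih => rw [pow_succ']; exact hX _ ih
  refine eq_top_iff.2 fun P _ => ?_
  rw [P.as_sum_range_C_mul_X_pow]
  exact S.sum_mem fun n _ => by
    rw [← Polynomial.smul_eq_C_mul]; exact S.smul_mem _ (hXn n)

section Functional

variable {q a b : ℝ} {L : Polynomial ℝ →ₗ[ℝ] ℝ}

/-- Favard's argument: a functional that annihilates all `pₙ` with `n ≥ 1` makes them pairwise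
orthogonal. -/
lemma map_mul_alSalamChihara_of_lt (hL : ∀ n, L (alSalamChihara q a b (n + 1)) = 0) {m n : ℕ}
    (h : m < n) : L (alSalamChihara q a b m * alSalamChihara q a b n) = 0 := by
  have key : ∀ m, (∀ n, m < n → L (alSalamChihara q a b m * alSalamChihara q a b n) = 0) ∧
      ∀ n, m + 1 < n → L (alSalamChihara q a b (m + 1) * alSalamChihara q a b n) = 0 := by
    intro m
    induction m with
    | zero =>
      constructor
      · rintro (_ | n) hn
        · omega
        · simpa [alSalamChihara] using hL n
      · rintro (_ | _ | n) hn
        · omega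
        · omega
        · have : alSalamChihara q a b (0 + 1) = Polynomial.X := rfl
          rw [this, X_mul_alSalamChihara]
          simp [hL]
    | succ m ih =>
      refine ⟨ih.2, ?_⟩
      rintro (_ | n) hn
      · omega
      have e : alSalamChihara q a b (m + 1 + 1) * alSalamChihara q a b (n + 1) =
          alSalamChihara q a b (m + 1) * (Polynomial.X * alSalamChihara q a b (n + 1)) -
          (a * qInt q (m + 1)) • (alSalamChihara q a b (m + 1) * alSalamChihara q a b (n + 1)) -
          ((1 + b * qInt q m) * qInt q (m + 1)) •
            (alSalamChihara q a b m * alSalamChihara q a b (n + 1)) := by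
        have := X_mul_alSalamChihara q a b m
        simp only [Polynomial.smul_eq_C_mul] at this ⊢
        linear_combination (-alSalamChihara q a b (n + 1)) * this
      rw [e, X_mul_alSalamChihara, mul_add, mul_add, mul_smul_comm, mul_smul_comm]
      simp only [map_sub, map_add, map_smul]
      rw [ih.2 (n + 2) (by omega), ih.2 (n + 1) (by omega), ih.2 n (by omega),
        ih.1 (n + 1) (by omega)]
      simp
  exact (key m).1 n h

lemma map_sq_alSalamChihara_succ (hL : ∀ n, L (alSalamChihara q a b (n + 1)) = 0) (n : ℕ) :
    L (alSalamChihara q a b (n + 1) * alSalamChihara q a b (n + 1)) =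
      (1 + b * qInt q n) * qInt q (n + 1) * L (alSalamChihara q a b n * alSalamChihara q a b n) := by
  have e : ∃ c d : ℝ, alSalamChihara q a b (n + 1) * alSalamChihara q a b (n + 1) =
      alSalamChihara q a b n * (Polynomial.X * alSalamChihara q a b (n + 1)) -
        c • (alSalamChihara q a b n * alSalamChihara q a b (n + 1)) -
        d • (alSalamChihara q a b (n - 1) * alSalamChihara q a b (n + 1)) := by
    cases n with
    | zero => exact ⟨0, 0, by simp [alSalamChihara]⟩
    | succ n =>
      refine ⟨a * qInt q (n + 1), (1 + b * qInt q n) * qInt q (n + 1), ?_⟩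
      have := X_mul_alSalamChihara q a b n
      simp only [Polynomial.smul_eq_C_mul, Nat.add_sub_cancel] at this ⊢
      linear_combination (-alSalamChihara q a b (n + 2)) * this
  obtain ⟨c, d, e⟩ := e
  rw [e, X_mul_alSalamChihara, mul_add, mul_add, mul_smul_comm, mul_smul_comm]
  simp only [map_sub, map_add, map_smul]
  rw [map_mul_alSalamChihara_of_lt hL (by omega : n < n + 2),
    map_mul_alSalamChihara_of_lt hL (by omega : n < n + 1),
    map_mul_alSalamChihara_of_lt hL (by omega : n - 1 < n + 1)]
  simp

end Functional

/-- Integration against a measure with finite moments, as a functional on polynomials. -/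
noncomputable def momentFunctional (μ : Measure ℝ)
    (h : ∀ P : Polynomial ℝ, Integrable (fun u => P.eval u) μ) : Polynomial ℝ →ₗ[ℝ] ℝ where
  toFun P := ∫ u, P.eval u ∂μ
  map_add' P Q := by simpa using integral_add (h P) (h Q)
  map_smul' c P := by simpa using integral_const_mul c (fun u => P.eval u)

/-! ### The generator annihilates the Al-Salam-Chihara polynomials of positive degree -/

/-- Coefficients of a power series that is constant near `0`. -/
lemma coeff_eq_zero_of_hasSum_const {c : ℕ → ℝ} {C ρ : ℝ} (hρ : 0 < ρ)
    (h : ∀ z : ℝ, |z| < ρ → HasSum (fun n => c n * z ^ n) C) (n : ℕ) : c (n + 1) = 0 := by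
  have h1 : HasFPowerSeriesAt (fun _ : ℝ => C) (FormalMultilinearSeries.ofScalars ℝ c) 0 := by
    rw [hasFPowerSeriesAt_iff]
    filter_upwards [Metric.ball_mem_nhds (0 : ℝ) hρ] with z hz
    simpa [mul_comm] using h z (by simpa using hz)
  have h2 : HasFPowerSeriesAt (fun _ : ℝ => C) (constFormalMultilinearSeries ℝ ℝ C) 0 :=
    hasFPowerSeriesAt_const
  have h3 := h1.eq_formalMultilinearSeries h2
  have h4 := congrArg (fun p => p.coeff (n + 1)) h3
  simp only [FormalMultilinearSeries.coeff_ofScalars] at h4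
  rw [h4, FormalMultilinearSeries.coeff, constFormalMultilinearSeries_apply_succ]
  rfl

namespace IsQExponentialFamily

variable {q a b : ℝ} {A B : EReal} {μ : Measure ℝ} {w : ℝ → ℝ → ℝ}

lemma integrable_of_continuous
    (hF : IsQExponentialFamily q (fun m => 1 + a * m + b * m ^ 2) A B μ w) {f : ℝ → ℝ}
    (hf : Continuous f) : Integrable f μ := by
  have := hF.isProbabilityMeasure_generator
  obtain ⟨R, -, hR⟩ := ae_abs_le_of_isCompact_support hF.isCompact_support
  exact integrable_of_continuous_of_ae_abs_le hR hf

lemma integral_density (hF : IsQExponentialFamily q (fun m => 1 + a * m + b * m ^ 2) A B μ w)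
    {m : ℝ} (hm : m ∈ openInterval A B) : ∫ u, w m u ∂μ = 1 := by
  rw [integral_eq_lintegral_of_nonneg_ae (hF.nonneg m hm) (hF.aemeasurable m hm).aestronglyMeasurable]
  have h := (hF.isProbabilityMeasure m hm).measure_univ
  rw [withDensity_apply _ MeasurableSet.univ, Measure.restrict_univ] at h
  rw [h, ENNReal.toReal_one]

/-- Integrating the expansion of `w(m, u)` in powers of `m` against `μ` gives the constant `1`. -/
lemma integral_alSalamChihara (hF : IsQExponentialFamily q (fun m => 1 + a * m + b * m ^ 2) A B μ w)
    (hq : |q| < 1) (hb : -1 + max q 0 < b) (n : ℕ) :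
    ∫ u, (alSalamChihara q a b (n + 1)).eval u ∂μ = 0 := by
  have := hF.isProbabilityMeasure_generator
  obtain ⟨ρ, hρ, h⟩ := hF.exists_eq_tsum hq hb
  have hs := scale_pos hb
  set s := √(b + 1 - q) with hsdef
  have hsum : ∀ m : ℝ, |m| < ρ →
      HasSum (fun n => (∫ u, ascNormalized q a b n u ∂μ) * s ^ n * m ^ n) 1 := by
    intro m hm
    obtain ⟨hmem, hu⟩ := h m hm
    have hint : ∀ n, Integrable (fun u => ascNormalized q a b n u * (s * m) ^ n) μ := fun n =>
      hF.integrable_of_continuous ((continuous_ascNormalized q a b n).mul_const _)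
    have hle : ∀ n, ∫ u, ‖ascNormalized q a b n u * (s * m) ^ n‖ ∂μ ≤ (1 / 2) ^ n := fun n => by
      have h1 : ∫ u, ‖ascNormalized q a b n u * (s * m) ^ n‖ ∂μ ≤ ∫ _u, (1 / 2 : ℝ) ^ n ∂μ := by
        refine integral_mono_ae (hint n).norm (integrable_const _) ?_
        filter_upwards [Measure.support_mem_ae] with u hu' using (hu u hu').1 n
      simpa using h1
    have h2 := hasSum_integral_of_summable_integral_norm hint
      (Summable.of_nonneg_of_le (fun n => integral_nonneg fun _ => norm_nonneg _) hle
        (summable_geometric_of_lt_one (by norm_num) (by norm_num)))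
    have h3 : ∫ u, ∑' n, ascNormalized q a b n u * (s * m) ^ n ∂μ = 1 := by
      rw [← hF.integral_density hmem]
      refine integral_congr_ae ?_
      filter_upwards [Measure.support_mem_ae] with u hu' using ((hu u hu').2).symm
    rw [h3] at h2
    refine h2.congr_fun fun n => ?_
    rw [integral_mul_const]
    ring
  have hc := coeff_eq_zero_of_hasSum_const hρ hsum n
  have h4 : ∫ u, ascNormalized q a b (n + 1) u ∂μ = 0 :=
    (mul_eq_zero.1 hc).resolve_right (pow_pos hs _).ne'
  simp_rw [eval_eq_mul_ascNormalized hq hb]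
  rw [integral_const_mul, h4, mul_zero]

end IsQExponentialFamily

/-! ### Norms of the normalised polynomials -/

/-- The squared `L²` norm of the `n`-th normalised Al-Salam-Chihara polynomial. -/
noncomputable def ascNormSq (q b : ℝ) (n : ℕ) : ℝ :=
  ∏ k ∈ Finset.range n, (1 - b / √(b + 1 - q) ^ 2 * q ^ k) / (1 - q ^ (k + 1))

lemma ascNormSq_factor_pos {q b : ℝ} (hq : |q| < 1) (hb : -1 + max q 0 < b) (k : ℕ) :
    0 < (1 - b / √(b + 1 - q) ^ 2 * q ^ k) / (1 - q ^ (k + 1)) := by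
  have h1 : 0 < 1 - q := by linarith [(abs_lt.1 hq).2]
  refine div_pos ?_ ?_
  · rw [scale_sq hb, sub_pos, div_mul_eq_mul_div, div_lt_one (add_one_sub_pos hb)]
    exact mul_pow_lt hq hb k
  · rw [← one_sub_mul_qInt]
    exact mul_pos h1 (qInt_succ_pos hq k)

lemma ascNormSq_pos {q b : ℝ} (hq : |q| < 1) (hb : -1 + max q 0 < b) (n : ℕ) :
    0 < ascNormSq q b n :=
  Finset.prod_pos fun k _ => ascNormSq_factor_pos hq hb k

lemma exists_tendsto_ascNormSq {q b : ℝ} (hq : |q| < 1) (hb : -1 + max q 0 < b) :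
    ∃ r > 0, Tendsto (ascNormSq q b) atTop (𝓝 r) := by
  set β := b / √(b + 1 - q) ^ 2
  set f : ℕ → ℝ := fun k => (1 - β * q ^ k) / (1 - q ^ (k + 1)) with hf
  have hfpos : ∀ k, 0 < f k := fun k => ascNormSq_factor_pos hq hb k
  have hp : Tendsto (fun k : ℕ => q ^ k) atTop (𝓝 0) := tendsto_pow_atTop_nhds_zero_of_abs_lt_one hq
  have hbd : Tendsto (fun k : ℕ => (q - β) / (1 - q ^ (k + 1))) atTop (𝓝 ((q - β) / (1 - 0))) :=
    tendsto_const_nhds.div (((tendsto_add_atTop_iff_nat 1).2 hp).const_sub 1) (by norm_num)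
  obtain ⟨C, hC⟩ := hbd.norm.bddAbove_range
  have hsum : Summable (fun k : ℕ => q ^ k * ((q - β) / (1 - q ^ (k + 1)))) := by
    refine Summable.of_norm_bounded
      ((summable_geometric_of_lt_one (abs_nonneg q) hq).mul_left C) fun k => ?_
    rw [norm_mul, norm_pow, mul_comm, Real.norm_eq_abs q]
    exact mul_le_mul_of_nonneg_right (hC ⟨k, rfl⟩) (by positivity)
  have hlog : Summable (fun k => Real.log (f k)) := by
    refine (Real.summable_log_one_add_of_summable hsum).congr fun k => ?_
    have hden : 1 - q ^ (k + 1) ≠ 0 := by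
      rw [← one_sub_mul_qInt]
      exact (mul_pos (by linarith [(abs_lt.1 hq).2]) (qInt_succ_pos hq k)).ne'
    congr 1
    simp only [hf]
    field_simp
    ring
  refine ⟨Real.exp (∑' k, Real.log (f k)), Real.exp_pos _, ?_⟩
  have h := (Real.continuous_exp.tendsto _).comp hlog.hasSum.tendsto_sum_nat
  refine h.congr fun n => ?_
  rw [Function.comp_apply, Real.exp_sum]
  exact Finset.prod_congr rfl fun k _ => Real.exp_log (hfpos k)

/-- A compactly supported probability measure annihilating all Al-Salam-Chihara polynomials of
positive degree. By Favard's argument these polynomials are then orthogonal. -/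
structure IsASCGenerator (q a b : ℝ) (μ : Measure ℝ) : Prop where
  isProbabilityMeasure : IsProbabilityMeasure μ
  isCompact_support : IsCompact μ.support
  integral_eq_zero : ∀ n, ∫ u, (alSalamChihara q a b (n + 1)).eval u ∂μ = 0

lemma IsQExponentialFamily.isASCGenerator {q a b : ℝ} {A B : EReal} {μ : Measure ℝ}
    {w : ℝ → ℝ → ℝ} (hF : IsQExponentialFamily q (fun m => 1 + a * m + b * m ^ 2) A B μ w)
    (hq : |q| < 1) (hb : -1 + max q 0 < b) : IsASCGenerator q a b μ :=
  ⟨hF.isProbabilityMeasure_generator, hF.isCompact_support, hF.integral_alSalamChihara hq hb⟩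

namespace IsASCGenerator

variable {q a b : ℝ} {μ : Measure ℝ}

lemma integrable (h : IsASCGenerator q a b μ) {f : ℝ → ℝ} (hf : Continuous f) : Integrable f μ := by
  have := h.isProbabilityMeasure
  obtain ⟨R, -, hR⟩ := ae_abs_le_of_isCompact_support h.isCompact_support
  exact integrable_of_continuous_of_ae_abs_le hR hf

lemma integrable_eval (h : IsASCGenerator q a b μ) (P : Polynomial ℝ) :
    Integrable (fun u => P.eval u) μ :=
  h.integrable P.continuous

lemma integral_mul_of_lt (h : IsASCGenerator q a b μ) {m n : ℕ} (hmn : m < n) :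
    ∫ u, (alSalamChihara q a b m).eval u * (alSalamChihara q a b n).eval u ∂μ = 0 := by
  simpa [momentFunctional] using map_mul_alSalamChihara_of_lt
    (L := momentFunctional μ h.integrable_eval) h.integral_eq_zero hmn

lemma integral_mul_of_ne (h : IsASCGenerator q a b μ) {m n : ℕ} (hmn : m ≠ n) :
    ∫ u, (alSalamChihara q a b m).eval u * (alSalamChihara q a b n).eval u ∂μ = 0 := by
  rcases lt_or_gt_of_ne hmn with hlt | hlt
  · exact h.integral_mul_of_lt hlt
  · simp_rw [mul_comm ((alSalamChihara q a b m).eval _)]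
    exact h.integral_mul_of_lt hlt

lemma integral_sq_succ (h : IsASCGenerator q a b μ) (n : ℕ) :
    ∫ u, (alSalamChihara q a b (n + 1)).eval u ^ 2 ∂μ =
      (1 + b * qInt q n) * qInt q (n + 1) * ∫ u, (alSalamChihara q a b n).eval u ^ 2 ∂μ := by
  simpa [momentFunctional, sq] using map_sq_alSalamChihara_succ
    (L := momentFunctional μ h.integrable_eval) h.integral_eq_zero n

lemma integral_sq (h : IsASCGenerator q a b μ) (hq : |q| < 1) (hb : -1 + max q 0 < b) (n : ℕ) :
    ∫ u, (alSalamChihara q a b n).eval u ^ 2 ∂μ =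
      (qFactorial q n * √(b + 1 - q) ^ n) ^ 2 * ascNormSq q b n := by
  induction n with
  | zero =>
    have := h.isProbabilityMeasure
    simp [alSalamChihara, qFactorial, ascNormSq]
  | succ n ih =>
    have hsucc : ascNormSq q b (n + 1) = ascNormSq q b n *
        ((1 - b / √(b + 1 - q) ^ 2 * q ^ n) / (1 - q ^ (n + 1))) := Finset.prod_range_succ _ n
    rw [h.integral_sq_succ, ih, qFactorial_succ, hsucc, ← one_sub_mul_qInt q (n + 1)]
    have hs := scale_pos hb
    have hs2 := scale_sq hb
    have hc := qInt_succ_pos hq n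
    have hq1 : 0 < 1 - q := by linarith [(abs_lt.1 hq).2]
    have e0 := one_sub_mul_qInt q n
    set s := √(b + 1 - q)
    have key : 1 + b * qInt q n = qInt q (n + 1) * s ^ 2 *
        ((1 - b / s ^ 2 * q ^ n) / ((1 - q) * qInt q (n + 1))) := by
      field_simp
      linear_combination b * e0 - hs2
    rw [key]
    ring

lemma isOrthogonalityMeasure (h : IsASCGenerator q a b μ) (hq : |q| < 1)
    (hb : -1 + max q 0 < b) : IsOrthogonalityMeasure μ (alSalamChihara q a b) where
  integrable := h.integrable_eval
  orthogonal _ _ hmn := h.integral_mul_of_ne hmn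
  norm_pos n := by
    rw [h.integral_sq hq hb]
    exact mul_pos (pow_pos (mul_pos (qFactorial_pos hq n) (pow_pos (scale_pos hb) n)) 2)
      (ascNormSq_pos hq hb n)

/-- Any orthogonality measure has the moments of the generator, hence equals it. -/
lemma eq_of_isOrthogonalityMeasure (h : IsASCGenerator q a b μ) {ν : Measure ℝ}
    [IsProbabilityMeasure ν] (hν : IsOrthogonalityMeasure ν (alSalamChihara q a b)) : ν = μ := by
  have := h.isProbabilityMeasure
  refine eq_of_moments_eq h.isCompact_support hν.integrable fun P => ?_
  have hL : momentFunctional ν hν.integrable = momentFunctional μ h.integrable_eval := by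
    refine LinearMap.ext_on_range (span_alSalamChihara q a b) fun n => ?_
    show ∫ u, (alSalamChihara q a b n).eval u ∂ν = ∫ u, (alSalamChihara q a b n).eval u ∂μ
    cases n with
    | zero => simp [alSalamChihara]
    | succ n =>
      rw [h.integral_eq_zero]
      simpa [alSalamChihara] using hν.orthogonal 0 (n + 1) (Nat.succ_ne_zero n).symm
  exact congrArg (fun L => L P) hL

lemma integral_ascNormalized_mul_of_ne (h : IsASCGenerator q a b μ) {m n : ℕ} (hmn : m ≠ n) :
    ∫ u, ascNormalized q a b m u * ascNormalized q a b n u ∂μ = 0 := by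
  simp_rw [ascNormalized, div_mul_div_comm]
  rw [integral_div, h.integral_mul_of_ne hmn, zero_div]

lemma integral_ascNormalized_sq (h : IsASCGenerator q a b μ) (hq : |q| < 1)
    (hb : -1 + max q 0 < b) (n : ℕ) :
    ∫ u, ascNormalized q a b n u * ascNormalized q a b n u ∂μ = ascNormSq q b n := by
  simp_rw [ascNormalized, div_mul_div_comm, ← sq]
  rw [integral_div, h.integral_sq hq hb, mul_div_cancel_left₀]
  exact (pow_pos (mul_pos (qFactorial_pos hq n) (pow_pos (scale_pos hb) n)) 2).ne'

/-! ### Atoms -/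

/-- Bessel's inequality for the indicator function of an atom, in terms of the reproducing kernel
`K u = ∑ gₙ(x) gₙ(u) / ‖gₙ‖²`: one has `μ {x} K(x)² ≤ ∫ K² = K(x)`. -/
lemma sum_sq_div_mul_measure_le (h : IsASCGenerator q a b μ) (hq : |q| < 1)
    (hb : -1 + max q 0 < b) (x : ℝ) (N : ℕ) :
    (∑ n ∈ Finset.range N, ascNormalized q a b n x ^ 2 / ascNormSq q b n) * μ.real {x} ≤ 1 := by
  have := h.isProbabilityMeasure
  set g := ascNormalized q a b with hg
  have hgc : ∀ n, Continuous (g n) := continuous_ascNormalized q a b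
  set K : ℕ → ℝ → ℝ := fun N u => ∑ n ∈ Finset.range N, g n x / ascNormSq q b n * g n u with hK
  have hKc : ∀ N, Continuous (K N) := fun N =>
    continuous_finsetSum _ fun n _ => continuous_const.mul (hgc n)
  have hKx : ∀ N, K N x = ∑ n ∈ Finset.range N, g n x ^ 2 / ascNormSq q b n := fun N =>
    Finset.sum_congr rfl fun n _ => by ring
  have horth : ∀ N, ∫ u, K N u * g N u ∂μ = 0 := fun N => by
    simp only [hK, Finset.sum_mul, mul_assoc]
    have hi : ∀ n, Integrable (fun u => g n x / ascNormSq q b n * (g n u * g N u)) μ := fun n =>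
      h.integrable (continuous_const.mul ((hgc n).mul (hgc N)))
    rw [integral_finsetSum _ fun n _ => hi n]
    refine Finset.sum_eq_zero fun n hn => ?_
    rw [integral_const_mul, h.integral_ascNormalized_mul_of_ne (Finset.mem_range.1 hn).ne, mul_zero]
  have hsq : ∀ N, ∫ u, K N u ^ 2 ∂μ = K N x := by
    intro N
    induction N with
    | zero => simp [hK]
    | succ N ih =>
      set c := g N x / ascNormSq q b N with hc
      have e : ∀ u, K (N + 1) u ^ 2 =
          K N u ^ 2 + ((2 * c) * (K N u * g N u) + c ^ 2 * (g N u * g N u)) := fun u => by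
        have : K (N + 1) u = K N u + c * g N u := Finset.sum_range_succ _ N
        rw [this]; ring
      simp_rw [e]
      have hi1 : Integrable (fun u => K N u ^ 2) μ := h.integrable ((hKc N).pow 2)
      have hi2 : Integrable (fun u => (2 * c) * (K N u * g N u)) μ :=
        h.integrable (continuous_const.mul ((hKc N).mul (hgc N)))
      have hi3 : Integrable (fun u => c ^ 2 * (g N u * g N u)) μ :=
        h.integrable (continuous_const.mul ((hgc N).mul (hgc N)))
      have hi23 : Integrable (fun u => 2 * c * (K N u * g N u) + c ^ 2 * (g N u * g N u)) μ :=
        hi2.add hi3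
      rw [integral_add hi1 hi23, integral_add hi2 hi3, integral_const_mul, integral_const_mul, horth, ih, h.integral_ascNormalized_sq hq hb]
      have : K (N + 1) x = K N x + c * g N x := Finset.sum_range_succ _ N
      rw [this, hc]
      have := (ascNormSq_pos hq hb N).ne'
      field_simp
      ring
  have hle : K N x ^ 2 * μ.real {x} ≤ K N x := by
    have hi : Integrable (fun u => K N u ^ 2) μ := h.integrable ((hKc N).pow 2)
    have h1 := setIntegral_le_integral (s := {x}) hi
      (Eventually.of_forall fun u => sq_nonneg (K N u))
    rwa [integral_singleton, smul_eq_mul, mul_comm, hsq N] at h1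
  rw [← hKx]
  have hnn : 0 ≤ K N x := by
    rw [hKx]
    exact Finset.sum_nonneg fun n _ => div_nonneg (sq_nonneg _) (ascNormSq_pos hq hb n).le
  rcases hnn.eq_or_lt with h0 | h0
  · rw [← h0]; simp
  · refine le_of_mul_le_mul_left ?_ h0
    linarith

lemma tendsto_zero_of_atom (h : IsASCGenerator q a b μ) (hq : |q| < 1) (hb : -1 + max q 0 < b)
    {x : ℝ} (hx : μ {x} ≠ 0) : Tendsto (fun n => ascNormalized q a b n x) atTop (𝓝 0) := by
  have := h.isProbabilityMeasure
  have hpos : 0 < μ.real {x} := ENNReal.toReal_pos hx (measure_ne_top _ _)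
  have hsum : Summable (fun n => ascNormalized q a b n x ^ 2 / ascNormSq q b n) :=
    summable_of_sum_range_le (fun n => div_nonneg (sq_nonneg _) (ascNormSq_pos hq hb n).le)
      (fun N => (le_div_iff₀ hpos).2 (h.sum_sq_div_mul_measure_le hq hb x N))
  obtain ⟨r, -, hr⟩ := exists_tendsto_ascNormSq hq hb
  have h1 := hsum.tendsto_atTop_zero.mul hr
  rw [zero_mul] at h1
  refine (tendsto_zero_iff_norm_tendsto_zero).2 ?_
  have h2 := h1.sqrt
  rw [Real.sqrt_zero] at h2
  refine h2.congr fun n => ?_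
  rw [div_mul_cancel₀ _ (ascNormSq_pos hq hb n).ne', Real.sqrt_sq_eq_abs, Real.norm_eq_abs]

end IsASCGenerator

lemma exists_root_norm_le_one (y : ℝ) :
    ∃ z : ℂ, 1 - y * z + z ^ 2 = 0 ∧ ‖z‖ ≤ 1 ∧ (2 < |y| → ‖z‖ < 1) := by
  obtain ⟨z, hz, hz1⟩ : ∃ z : ℂ, 1 - y * z + z ^ 2 = 0 ∧ ‖z‖ ≤ 1 := by
    obtain ⟨d, hd⟩ := IsAlgClosed.exists_pow_nat_eq ((y : ℂ) ^ 2 - 4) two_pos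
    have hz : 1 - y * ((y + d) / 2) + ((y + d) / 2) ^ 2 = 0 := by linear_combination hd / 4
    rcases le_total ‖((y : ℂ) + d) / 2‖ 1 with h1 | h1
    · exact ⟨_, hz, h1⟩
    · have h0 : ((y : ℂ) + d) / 2 ≠ 0 := norm_pos_iff.1 (by linarith)
      refine ⟨(((y : ℂ) + d) / 2)⁻¹, ?_, by rw [norm_inv]; exact inv_le_one_of_one_le₀ h1⟩
      set z := ((y : ℂ) + d) / 2
      field_simp
      linear_combination hz
  refine ⟨z, hz, hz1, fun hy => hz1.lt_of_ne fun h1 => ?_⟩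
  -- on the unit circle `y = z + z⁻¹ = 2 re z`
  have h0 : z ≠ 0 := norm_pos_iff.1 (by linarith)
  have hc : z * (starRingEnd ℂ) z = 1 := by rw [Complex.mul_conj']; simp [h1]
  have hyz : (y : ℂ) = z + (starRingEnd ℂ) z := by
    refine mul_left_cancel₀ h0 ?_
    linear_combination -hz - hc
  rw [Complex.add_conj] at hyz
  have hyr : y = 2 * z.re := by exact_mod_cast hyz
  have h3 := Complex.abs_re_le_norm z
  rw [h1] at h3
  rw [hyr, abs_mul, abs_two] at hy
  linarith

/-- If the roots of `1 + α x + β x²` are not real and `β < 1`, they lie outside the unit disc: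
their product is `1 / β`. -/
lemma one_lt_norm_of_root {α β : ℝ} (h : α ^ 2 < 4 * β) (hβ : β < 1) {x : ℂ}
    (hx : 1 + α * x + β * x ^ 2 = 0) : 1 < ‖x‖ := by
  have hre := congrArg Complex.re hx
  have him := congrArg Complex.im hx
  simp [sq] at hre him
  have hβ0 : 0 < β := by nlinarith [sq_nonneg α]
  have him' : x.im * (α + 2 * β * x.re) = 0 := by linarith
  rcases mul_eq_zero.1 him' with h0 | h0
  · rw [h0] at hre
    nlinarith [sq_nonneg (2 * β * x.re + α)]
  · have h1 : β * ‖x‖ ^ 2 = 1 := by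
      rw [Complex.sq_norm, Complex.normSq_apply]
      linear_combination (-1) * hre + x.re * h0
    have h2 : 1 < ‖x‖ ^ 2 := by nlinarith [sq_nonneg ‖x‖]
    exact (one_lt_sq_iff₀ (norm_nonneg x)).1 h2

/-- Where the normalised polynomials are `o(‖z‖⁻ⁿ)` for a root `z` of `1 - y z + z²`, the numerator of the generating
function vanishes at some `q ^ k z`. -/
lemma exists_numerator_eq_zero_of_tendsto {q a b : ℝ} (hq : |q| < 1) (hb : -1 + max q 0 < b) {u : ℝ}
    {z : ℂ} (hz : 1 - (ascVariable q a b u : ℝ) * z + z ^ 2 = 0)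
    (hg : Tendsto (fun n => |ascNormalized q a b n u| * ‖z‖ ^ n) atTop (𝓝 0)) :
    ∃ k : ℕ, 1 + ((a / √(b + 1 - q) : ℝ) : ℂ) * ((q : ℂ) ^ k * z) +
      ((b / √(b + 1 - q) ^ 2 : ℝ) : ℂ) * ((q : ℂ) ^ k * z) ^ 2 = 0 := by
  refine ((ascNormalized_rec hq hb a u).map Complex.ofRealHom).exists_numerator_eq_zero
    (by simpa using hq) hz (tendsto_zero_iff_norm_tendsto_zero.2 ?_)
  simpa using hg

lemma IsASCGenerator.measure_singleton_eq_zero {q a b : ℝ} {μ : Measure ℝ}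
    (h : IsASCGenerator q a b μ) (hq : |q| < 1) (hb : -1 + max q 0 < b) (hab : a ^ 2 < 4 * b)
    (x : ℝ) : μ {x} = 0 := by
  by_contra hx
  obtain ⟨z, hz, hz1, -⟩ := exists_root_norm_le_one (ascVariable q a b x)
  have hg := h.tendsto_zero_of_atom hq hb hx
  have hg' : Tendsto (fun n => |ascNormalized q a b n x| * ‖z‖ ^ n) atTop (𝓝 0) := by
    refine squeeze_zero (fun n => by positivity) (fun n => ?_) (by simpa using hg.abs)
    exact mul_le_of_le_one_right (abs_nonneg _) (pow_le_one₀ (norm_nonneg z) hz1)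
  obtain ⟨k, hk⟩ := exists_numerator_eq_zero_of_tendsto hq hb hz hg'
  have hs := scale_pos hb
  have hs2 := scale_sq hb
  have h1 : (a / √(b + 1 - q)) ^ 2 < 4 * (b / √(b + 1 - q) ^ 2) := by
    rw [div_pow, ← mul_div_assoc]
    exact div_lt_div_of_pos_right hab (pow_pos hs 2)
  have h2 : b / √(b + 1 - q) ^ 2 < 1 := by
    rw [div_lt_one (pow_pos hs 2), hs2]
    linarith [(abs_lt.1 hq).2]
  have h3 := one_lt_norm_of_root h1 h2 hk
  rw [norm_mul, norm_pow] at h3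
  have h4 : ‖(q : ℂ)‖ ^ k ≤ 1 := pow_le_one₀ (norm_nonneg _) (by simpa using hq.le)
  have h5 : ‖(q : ℂ)‖ ^ k * ‖z‖ ≤ 1 * 1 := mul_le_mul h4 hz1 (norm_nonneg z) zero_le_one
  linarith

/-! ### Outside the interval: a countable exceptional set -/

/-- The points `u` for which a zero of the numerator `∏ (1 + α qᵏ z + β (qᵏ z)²)` of the generating
function coincides with a zero of `1 - y z + z²`. -/
def ascExceptionalSet (q a b : ℝ) : Set ℝ :=
  {u | ∃ z : ℂ, 1 - (ascVariable q a b u : ℝ) * z + z ^ 2 = 0 ∧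
    ∃ k : ℕ, 1 + ((a / √(b + 1 - q) : ℝ) : ℂ) * ((q : ℂ) ^ k * z) +
      ((b / √(b + 1 - q) ^ 2 : ℝ) : ℂ) * ((q : ℂ) ^ k * z) ^ 2 = 0}

lemma countable_ascExceptionalSet {q b : ℝ} (hq : |q| < 1) (hb : -1 + max q 0 < b) (a : ℝ) :
    (ascExceptionalSet q a b).Countable := by
  set α : ℂ := ((a / √(b + 1 - q) : ℝ) : ℂ) with hα
  set β : ℂ := ((b / √(b + 1 - q) ^ 2 : ℝ) : ℂ) with hβ
  set P : ℕ → Polynomial ℂ := fun k => 1 + Polynomial.C (α * (q : ℂ) ^ k) * Polynomial.X +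
    Polynomial.C (β * ((q : ℂ) ^ k) ^ 2) * Polynomial.X ^ 2 with hP
  have hP0 : ∀ k, P k ≠ 0 := fun k h0 => by
    have := congrArg (Polynomial.eval 0) h0
    simp [hP] at this
  have hZ : (⋃ k, {z : ℂ | (P k).IsRoot z}).Countable :=
    Set.countable_iUnion fun k => (Polynomial.finite_setOfPred_isRoot (hP0 k)).countable
  have hs := (scale_pos hb).ne'
  have hq1 : 1 - q ≠ 0 := by linarith [(abs_lt.1 hq).2]
  have hinj : Function.Injective (fun u : ℝ => ((ascVariable q a b u : ℝ) : ℂ)) := by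
    intro u v huv
    have h1 : ascVariable q a b u = ascVariable q a b v := Complex.ofReal_injective huv
    rw [ascVariable, ascVariable, div_left_inj' hs, sub_left_inj] at h1
    exact mul_left_cancel₀ hq1 h1
  refine ((hZ.image fun z => (1 + z ^ 2) / z).preimage hinj).mono ?_
  rintro u ⟨z, hz, k, hk⟩
  have hz0 : z ≠ 0 := by rintro rfl; simp at hz
  refine ⟨z, Set.mem_iUnion.2 ⟨k, ?_⟩, ?_⟩
  · show (P k).eval z = 0
    rw [← hα, ← hβ] at hk
    simp only [hP, Polynomial.eval_add, Polynomial.eval_mul, Polynomial.eval_C, Polynomial.eval_X,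
      Polynomial.eval_pow, Polynomial.eval_one]
    linear_combination hk
  · show (1 + z ^ 2) / z = _
    rw [div_eq_iff hz0]
    linear_combination hz

namespace IsASCGenerator

variable {q a b : ℝ} {μ : Measure ℝ}

/-- By the Borel-Cantelli lemma the normalised polynomials grow at most linearly almost
everywhere. -/
lemma ae_eventually_abs_lt (h : IsASCGenerator q a b μ) (hq : |q| < 1) (hb : -1 + max q 0 < b) :
    ∀ᵐ u ∂μ, ∀ᶠ n : ℕ in atTop, |ascNormalized q a b n u| < n + 1 := by
  have := h.isProbabilityMeasure
  obtain ⟨r, -, hr⟩ := exists_tendsto_ascNormSq hq hb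
  obtain ⟨C, hC⟩ := hr.bddAbove_range
  have hC' : ∀ n, ascNormSq q b n ≤ C := fun n => hC ⟨n, rfl⟩
  have hbound : ∀ n : ℕ, μ {u | (n : ℝ) + 1 ≤ |ascNormalized q a b n u|} ≤
      ENNReal.ofReal (C * (1 / ((n : ℝ) + 1) ^ 2)) := fun n => by
    have hsq : {u | (n : ℝ) + 1 ≤ |ascNormalized q a b n u|} ⊆
        {u | ((n : ℝ) + 1) ^ 2 ≤ ascNormalized q a b n u * ascNormalized q a b n u} := fun u hu => by
      show ((n : ℝ) + 1) ^ 2 ≤ _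
      rw [← sq, ← sq_abs (ascNormalized q a b n u)]
      exact pow_le_pow_left₀ (by positivity) hu 2
    have hM := mul_meas_ge_le_integral_of_nonneg (μ := μ)
      (f := fun u => ascNormalized q a b n u * ascNormalized q a b n u)
      (Eventually.of_forall fun u => mul_self_nonneg _)
      (h.integrable ((continuous_ascNormalized q a b n).mul (continuous_ascNormalized q a b n)))
      (((n : ℝ) + 1) ^ 2)
    rw [h.integral_ascNormalized_sq hq hb] at hM
    rw [← ofReal_measureReal]
    refine ENNReal.ofReal_le_ofReal ((measureReal_mono hsq).trans ?_)
    rw [mul_one_div, le_div_iff₀ (by positivity), mul_comm]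
    exact hM.trans (hC' n)
  have hsum : Summable (fun n : ℕ => C * (1 / ((n : ℝ) + 1) ^ 2)) := by
    have h1 := (summable_nat_add_iff 1).2 (Real.summable_one_div_nat_pow.2 one_lt_two)
    exact (h1.congr fun n => by push_cast; rfl).mul_left C
  have hfin : ∑' n : ℕ, μ {u | (n : ℝ) + 1 ≤ |ascNormalized q a b n u|} ≠ ⊤ :=
    ne_top_of_le_ne_top hsum.tsum_ofReal_ne_top (ENNReal.tsum_le_tsum hbound)
  filter_upwards [ae_eventually_notMem hfin] with u hu
  filter_upwards [hu] with n hn using not_le.1 hn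

lemma ae_abs_le_two_or_mem (h : IsASCGenerator q a b μ) (hq : |q| < 1) (hb : -1 + max q 0 < b) :
    ∀ᵐ u ∂μ, |ascVariable q a b u| ≤ 2 ∨ u ∈ ascExceptionalSet q a b := by
  filter_upwards [h.ae_eventually_abs_lt hq hb] with u hu
  refine or_iff_not_imp_left.2 fun hy => ?_
  obtain ⟨z, hz, -, hz1⟩ := exists_root_norm_le_one (ascVariable q a b u)
  have hz1 := hz1 (not_le.1 hy)
  refine ⟨z, hz, exists_numerator_eq_zero_of_tendsto hq hb hz ?_⟩
  have hlim : Tendsto (fun n : ℕ => ((n : ℝ) + 1) * ‖z‖ ^ n) atTop (𝓝 0) := by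
    have h1 := (tendsto_self_mul_const_pow_of_lt_one (norm_nonneg z) hz1).add
      (tendsto_pow_atTop_nhds_zero_of_lt_one (norm_nonneg z) hz1)
    rw [add_zero] at h1
    exact h1.congr fun n => by ring
  refine squeeze_zero' (Eventually.of_forall fun n => by positivity) ?_ hlim
  filter_upwards [hu] with n hn
  gcongr

end IsASCGenerator

/-! ### Inside the interval: uniform bounds -/

namespace QChebyshevRec

variable {q : ℝ}

/-- Away from `y = ± 2` the recurrence is a summable perturbation of a rotation: the quadratic form
`gₙ₊₁² - y gₙ gₙ₊₁ + gₙ²`, which the unperturbed recurrence preserves, grows by a factor of at most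
`1 + c |q|ⁿ` at each step. -/
lemma exists_sq_le (hq : |q| < 1) (α β : ℝ) {δ : ℝ} (hδ : 0 < δ) :
    ∃ M > 0, ∀ (y : ℝ) (g : ℕ → ℝ), QChebyshevRec q α β y g → |y| ≤ 2 - δ → ∀ n, g n ^ 2 ≤ M := by
  have hq' : 0 < 1 - |q| := by linarith
  set C := (2 + |α| + 1 + |β|) / (1 - |q|) + |α| + |β| with hC
  have hC0 : 0 < C := by positivity
  set c := 4 / δ * (2 * C + C ^ 2) with hc
  have hc0 : 0 < c := by positivity
  set E₀ := (1 + (2 + |α|) / (1 - |q|)) ^ 2 with hE₀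
  refine ⟨2 / δ * (E₀ * Real.exp (c / (1 - |q|))), by positivity, fun y g h hy n => ?_⟩
  have hy2 : |y| ≤ 2 := by linarith
  have hpow : ∀ k : ℕ, |q ^ k| ≤ 1 := fun k => by
    rw [abs_pow]; exact pow_le_one₀ (abs_nonneg _) hq.le
  have hden : ∀ k : ℕ, 1 - |q| ≤ |1 - q ^ (k + 1)| := one_sub_abs_le_abs_one_sub_pow hq
  set E : ℕ → ℝ := fun n => g (n + 1) ^ 2 - y * g n * g (n + 1) + g n ^ 2 with hE
  -- the quadratic form is coercive
  have hcoer : ∀ n, δ / 2 * (g n ^ 2 + g (n + 1) ^ 2) ≤ E n := fun n => by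
    have h1 : y * g n * g (n + 1) ≤ |y| * (|g n| * |g (n + 1)|) := by
      rw [← abs_mul, ← abs_mul, ← mul_assoc]; exact le_abs_self _
    have h2 : |g n| * |g (n + 1)| ≤ (g n ^ 2 + g (n + 1) ^ 2) / 2 := by
      have := two_mul_le_add_sq |g n| |g (n + 1)|
      rw [sq_abs, sq_abs] at this
      linarith
    have h3 : |y| * (|g n| * |g (n + 1)|) ≤ (2 - δ) * ((g n ^ 2 + g (n + 1) ^ 2) / 2) :=
      mul_le_mul hy h2 (by positivity) ((abs_nonneg y).trans hy)
    simp only [hE]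
    linarith
  have hstep : ∀ n, E (n + 1) ≤ E n * (1 + c * |q| ^ n) := fun n => by
    set t := |g n| + |g (n + 1)| with ht
    have ht0 : 0 ≤ t := by positivity
    set e := g (n + 2) - (y * g (n + 1) - g n) with he
    have hg2 : |g (n + 2)| ≤ (2 + |α| + 1 + |β|) / (1 - |q|) * t := by
      have h1 := congrArg abs (h.add_two n)
      rw [abs_mul] at h1
      have h2 := mul_le_mul_of_nonneg_right (hden (n + 1)) (abs_nonneg (g (n + 2)))
      have e1 : |y + α * q ^ (n + 1)| ≤ 2 + |α| := by
        refine (abs_add_le _ _).trans (add_le_add hy2 ?_)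
        rw [abs_mul]; exact mul_le_of_le_one_right (abs_nonneg _) (hpow _)
      have e2 : |1 - β * q ^ n| ≤ 1 + |β| := by
        refine (abs_sub _ _).trans ?_
        rw [abs_one, abs_mul]
        exact add_le_add le_rfl (mul_le_of_le_one_right (abs_nonneg _) (hpow _))
      have h3 : |(y + α * q ^ (n + 1)) * g (n + 1) - (1 - β * q ^ n) * g n| ≤
          (2 + |α|) * |g (n + 1)| + (1 + |β|) * |g n| := by
        refine (abs_sub _ _).trans ?_
        rw [abs_mul, abs_mul]
        gcongr
      have h4 : (2 + |α|) * |g (n + 1)| + (1 + |β|) * |g n| ≤ (2 + |α| + 1 + |β|) * t := by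
        have := mul_nonneg (by positivity : 0 ≤ 2 + |α|) (abs_nonneg (g n))
        have := mul_nonneg (by positivity : 0 ≤ 1 + |β|) (abs_nonneg (g (n + 1)))
        rw [ht]
        linarith
      rw [div_mul_eq_mul_div, le_div_iff₀ hq', mul_comm]
      exact h2.trans ((h1.le.trans h3).trans h4)
    have hee : |e| ≤ C * |q| ^ n * t := by
      have e1 : e = q ^ n * (q ^ 2 * g (n + 2) + α * q * g (n + 1) + β * g n) := by
        rw [he]; linear_combination h.add_two n
      have e2 : |q ^ 2 * g (n + 2) + α * q * g (n + 1) + β * g n| ≤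
          |g (n + 2)| + |α| * |g (n + 1)| + |β| * |g n| := by
        refine (abs_add_three _ _ _).trans ?_
        rw [abs_mul, abs_mul, abs_mul, abs_mul β]
        have h1 : |q ^ 2| * |g (n + 2)| ≤ |g (n + 2)| :=
          mul_le_of_le_one_left (abs_nonneg _) (hpow 2)
        have h2 : |α| * |q| ≤ |α| := mul_le_of_le_one_right (abs_nonneg _) hq.le
        gcongr
      have e3 : |g (n + 2)| + |α| * |g (n + 1)| + |β| * |g n| ≤ C * t := by
        have := mul_nonneg (abs_nonneg α) (abs_nonneg (g n))
        have := mul_nonneg (abs_nonneg β) (abs_nonneg (g (n + 1)))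
        have h5 : C * t = (2 + |α| + 1 + |β|) / (1 - |q|) * t + |α| * t + |β| * t := by
          rw [hC]; ring
        have h6 : |α| * t = |α| * |g n| + |α| * |g (n + 1)| := mul_add _ _ _
        have h7 : |β| * t = |β| * |g n| + |β| * |g (n + 1)| := mul_add _ _ _
        linarith
      rw [e1, abs_mul, abs_pow]
      calc |q| ^ n * _ ≤ |q| ^ n * (C * t) := by gcongr; exact e2.trans e3
        _ = _ := by ring
    have hEe : E (n + 1) = E n + e * (y * g (n + 1) - 2 * g n) + e ^ 2 := by
      have : g (n + 2) = y * g (n + 1) - g n + e := by rw [he]; ring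
      simp only [hE]
      rw [this]
      ring
    have hqn : |q| ^ n ≤ 1 := pow_le_one₀ (abs_nonneg q) hq.le
    have h1 : e * (y * g (n + 1) - 2 * g n) ≤ 2 * C * |q| ^ n * t ^ 2 := by
      have h2 : |y * g (n + 1) - 2 * g n| ≤ 2 * t := by
        refine (abs_sub _ _).trans ?_
        rw [abs_mul, abs_mul, abs_two, ht]
        have := mul_le_mul_of_nonneg_right hy2 (abs_nonneg (g (n + 1)))
        linarith
      calc e * (y * g (n + 1) - 2 * g n) ≤ |e| * |y * g (n + 1) - 2 * g n| := by
            rw [← abs_mul]; exact le_abs_self _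
        _ ≤ (C * |q| ^ n * t) * (2 * t) := by gcongr
        _ = _ := by ring
    have h2 : e ^ 2 ≤ C ^ 2 * |q| ^ n * t ^ 2 := by
      calc e ^ 2 = |e| ^ 2 := (sq_abs e).symm
        _ ≤ (C * |q| ^ n * t) ^ 2 := by gcongr
        _ = C ^ 2 * (|q| ^ n * |q| ^ n) * t ^ 2 := by ring
        _ ≤ C ^ 2 * (|q| ^ n * 1) * t ^ 2 := by gcongr
        _ = _ := by ring
    have ht2 : t ^ 2 ≤ 4 / δ * E n := by
      have h3 : t ^ 2 ≤ 2 * (g n ^ 2 + g (n + 1) ^ 2) := by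
        have := two_mul_le_add_sq |g n| |g (n + 1)|
        rw [sq_abs, sq_abs] at this
        rw [ht, add_sq, sq_abs, sq_abs]
        linarith
      have h4 := mul_le_mul_of_nonneg_left (hcoer n) (by positivity : 0 ≤ 4 / δ)
      have h5 : 4 / δ * (δ / 2 * (g n ^ 2 + g (n + 1) ^ 2)) = 2 * (g n ^ 2 + g (n + 1) ^ 2) := by
        field_simp; norm_num
      linarith
    have h6 : (2 * C + C ^ 2) * |q| ^ n * t ^ 2 ≤ (2 * C + C ^ 2) * |q| ^ n * (4 / δ * E n) := by
      gcongr
    rw [hEe]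
    have h7 : E n * (1 + c * |q| ^ n) = E n + (2 * C + C ^ 2) * |q| ^ n * (4 / δ * E n) := by
      rw [hc]; ring
    rw [h7]
    linarith
  have hE0 : E 0 ≤ E₀ := by
    have h1 : |g 1| ≤ (2 + |α|) / (1 - |q|) := by
      have h2 := congrArg abs h.one
      rw [abs_mul] at h2
      have h3 := mul_le_mul_of_nonneg_right (hden 0) (abs_nonneg (g 1))
      simp only [zero_add, pow_one] at h3
      have h4 := (abs_add_le y α).trans (add_le_add_left hy2 |α|)
      rw [le_div_iff₀ hq', mul_comm]
      linarith
    have h2 : -(y * g 1) ≤ 2 * |g 1| := by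
      refine (neg_le_abs _).trans ?_
      rw [abs_mul]
      gcongr
    have h3 : E 0 ≤ (1 + |g 1|) ^ 2 := by
      simp only [hE, zero_add, h.zero]
      rw [add_sq, sq_abs]
      linarith
    exact h3.trans (by rw [hE₀]; gcongr)
  have hEn : ∀ n, E n ≤ E₀ * Real.exp (∑ k ∈ Finset.range n, c * |q| ^ k) := by
    intro n
    induction n with
    | zero => simpa using hE0
    | succ n ih =>
      rw [Finset.sum_range_succ, Real.exp_add, ← mul_assoc]
      refine (hstep n).trans ?_
      have h1 : 1 + c * |q| ^ n ≤ Real.exp (c * |q| ^ n) := by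
        linarith [Real.add_one_le_exp (c * |q| ^ n)]
      gcongr
  have hsum : ∑ k ∈ Finset.range n, c * |q| ^ k ≤ c / (1 - |q|) := by
    rw [← Finset.mul_sum, div_eq_mul_inv, ← tsum_geometric_of_lt_one (abs_nonneg q) hq]
    gcongr
    exact (summable_geometric_of_lt_one (abs_nonneg q) hq).sum_le_tsum _ fun k _ => by positivity
  have h1 : E n ≤ E₀ * Real.exp (c / (1 - |q|)) :=
    (hEn n).trans (by gcongr)
  have h2 := hcoer n
  rw [div_mul_eq_mul_div, le_div_iff₀ hδ]
  have h3 := mul_nonneg hδ.le (sq_nonneg (g (n + 1)))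
  linarith

end QChebyshevRec

/-! ### Inside the interval: the weak limit of `gₙ² μ` -/

/-- The parametrisation of the interval by `[0, π]` in which `ascVariable` is `2 cos θ`. -/
noncomputable def ascPoint (q a b θ : ℝ) : ℝ :=
  (a + 2 * √(b + 1 - q) * Real.cos θ) / (1 - q)

lemma continuous_ascPoint (q a b : ℝ) : Continuous (ascPoint q a b) := by
  unfold ascPoint
  fun_prop

lemma eq_ascVariable {q b : ℝ} (hq : |q| < 1) (hb : -1 + max q 0 < b) (a u : ℝ) :
    u = (a + √(b + 1 - q) * ascVariable q a b u) / (1 - q) := by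
  have hs := (scale_pos hb).ne'
  have hq1 : 1 - q ≠ 0 := by linarith [(abs_lt.1 hq).2]
  rw [ascVariable]
  field_simp
  ring

lemma integral_cos_sub_mul (i j : ℕ) :
    ∫ θ in (0 : ℝ)..Real.pi, Real.cos (((i : ℝ) - j) * θ) = if i = j then Real.pi else 0 := by
  split_ifs with hij
  · simp [hij]
  · have h0 : (i : ℝ) - j ≠ 0 := sub_ne_zero.2 (by exact_mod_cast hij)
    rw [intervalIntegral.integral_comp_mul_left (fun x => Real.cos x) h0, integral_cos, mul_zero,
      Real.sin_zero, sub_zero]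
    have h1 : ((i : ℝ) - j) = (((i : ℤ) - (j : ℤ) : ℤ) : ℝ) := by push_cast; rfl
    rw [h1, Real.sin_int_mul_pi, smul_zero]

namespace IsASCGenerator

variable {q a b : ℝ} {μ : Measure ℝ}

/-- The matrix elements of multiplication by a polynomial `P` in the basis `gₙ` converge to those of
the unperturbed (Chebyshev) case, that is, to Fourier coefficients of `P`. The induction step is
the three-term recurrence on one side, and `2 cos θ cos (k θ) = cos ((k + 1) θ) + cos ((k - 1) θ)`
on the other. -/
lemma tendsto_integral_polynomial (h : IsASCGenerator q a b μ) (hq : |q| < 1)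
    (hb : -1 + max q 0 < b) {r : ℝ} (hr : Tendsto (ascNormSq q b) atTop (𝓝 r))
    (P : Polynomial ℝ) : ∀ i j : ℕ,
    Tendsto (fun n => ∫ u, P.eval u *
      (ascNormalized q a b (n + i) u * ascNormalized q a b (n + j) u) ∂μ) atTop
      (𝓝 (r / Real.pi *
        ∫ θ in (0 : ℝ)..Real.pi, P.eval (ascPoint q a b θ) * Real.cos (((i : ℝ) - j) * θ))) := by
  have hpi := Real.pi_pos.ne'
  have hgc : ∀ n, Continuous (ascNormalized q a b n) := continuous_ascNormalized q a b
  have huc := continuous_ascPoint q a b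
  have hq1 : 1 - q ≠ 0 := by linarith [(abs_lt.1 hq).2]
  have hint : ∀ (Q : Polynomial ℝ) (m n : ℕ),
      Integrable (fun u => Q.eval u * (ascNormalized q a b m u * ascNormalized q a b n u)) μ :=
    fun Q m n => h.integrable (Q.continuous.mul ((hgc m).mul (hgc n)))
  have hintc : ∀ (Q : Polynomial ℝ) (x : ℝ), IntervalIntegrable
      (fun θ => Q.eval (ascPoint q a b θ) * Real.cos (x * θ)) volume 0 Real.pi := fun Q x =>
    ((Q.continuous.comp huc).mul (by fun_prop)).intervalIntegrable _ _
  have hp : Tendsto (fun n : ℕ => q ^ n) atTop (𝓝 0) := tendsto_pow_atTop_nhds_zero_of_abs_lt_one hq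
  induction P using Polynomial.induction_on' with
  | add P Q hP hQ =>
    intro i j
    have h1 := (hP i j).add (hQ i j)
    rw [← mul_add, ← intervalIntegral.integral_add (hintc P _) (hintc Q _)] at h1
    simp_rw [← integral_add (hint P _ _) (hint Q _ _), ← add_mul, ← Polynomial.eval_add] at h1
    exact h1
  | monomial k c =>
    induction k with
    | zero =>
      intro i j
      simp only [Polynomial.monomial_zero_left, Polynomial.eval_C, integral_const_mul,
        intervalIntegral.integral_const_mul, integral_cos_sub_mul]
      by_cases hij : i = j
      · subst hij
        simp only [h.integral_ascNormalized_sq hq hb, if_true]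
        have h1 := (((tendsto_add_atTop_iff_nat i).2 hr).const_mul c)
        convert h1 using 2
        field_simp
      · have h0 : ∀ n, ∫ u, ascNormalized q a b (n + i) u * ascNormalized q a b (n + j) u ∂μ = 0 :=
          fun n => h.integral_ascNormalized_mul_of_ne (by omega)
        simp [h0, hij]
    | succ k ih =>
      set P := Polynomial.monomial k c with hPdef
      have hmon : Polynomial.monomial (k + 1) c = P * Polynomial.X := by
        rw [hPdef, Polynomial.monomial_mul_X]
      rw [hmon]
      set s := √(b + 1 - q) with hsdef
      -- the recurrence lowers an index, so that index is first made positive by a shift of `n`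
      have hstep : ∀ i j : ℕ, Tendsto (fun n => ∫ u, (P * Polynomial.X).eval u *
          (ascNormalized q a b (n + (i + 1)) u * ascNormalized q a b (n + (j + 1)) u) ∂μ) atTop
          (𝓝 (r / Real.pi * ∫ θ in (0 : ℝ)..Real.pi,
            (P * Polynomial.X).eval (ascPoint q a b θ) * Real.cos (((i : ℝ) - j) * θ))) := by
        intro i j
        set I : ℕ → ℕ → ℝ := fun m n =>
          ∫ u, P.eval u * (ascNormalized q a b m u * ascNormalized q a b n u) ∂μ with hI
        have hexp : ∀ n, ∫ u, (P * Polynomial.X).eval u *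
            (ascNormalized q a b (n + (i + 1)) u * ascNormalized q a b (n + (j + 1)) u) ∂μ =
            (a * I (n + (i + 1)) (n + (j + 1)) + s *
              ((1 - q ^ (n + (j + 2))) * I (n + (i + 1)) (n + (j + 2)) -
                a / s * q ^ (n + (j + 1)) * I (n + (i + 1)) (n + (j + 1)) +
                (1 - b / s ^ 2 * q ^ (n + j)) * I (n + (i + 1)) (n + j))) / (1 - q) := fun n => by
          have e : ∀ u, (P * Polynomial.X).eval u *
              (ascNormalized q a b (n + (i + 1)) u * ascNormalized q a b (n + (j + 1)) u) =
              (a / (1 - q) - s / (1 - q) * (a / s * q ^ (n + (j + 1)))) * (P.eval u *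
                (ascNormalized q a b (n + (i + 1)) u * ascNormalized q a b (n + (j + 1)) u)) +
              (s / (1 - q) * (1 - q ^ (n + (j + 2))) * (P.eval u *
                (ascNormalized q a b (n + (i + 1)) u * ascNormalized q a b (n + (j + 2)) u)) +
              s / (1 - q) * (1 - b / s ^ 2 * q ^ (n + j)) * (P.eval u *
                (ascNormalized q a b (n + (i + 1)) u * ascNormalized q a b (n + j) u))) := fun u => by
            have h1 := (ascNormalized_rec hq hb a u).add_two (n + j)
            have h2 := eq_ascVariable hq hb a u
            rw [← hsdef] at h1 h2
            rw [Polynomial.eval_mul, Polynomial.eval_X]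
            have e1 : n + j + 1 = n + (j + 1) := rfl
            have e2 : n + j + 2 = n + (j + 2) := rfl
            rw [e1, e2] at h1
            set g0 := ascNormalized q a b (n + j) u
            set g1 := ascNormalized q a b (n + (j + 1)) u
            set g2 := ascNormalized q a b (n + (j + 2)) u
            set f := ascNormalized q a b (n + (i + 1)) u
            set y := ascVariable q a b u
            have h3 : u = a / (1 - q) + s / (1 - q) * y := by rw [h2]; ring
            linear_combination (P.eval u * f * g1) * h3 - (s / (1 - q) * P.eval u * f) * h1
          simp_rw [e]
          have hi := fun m n (x : ℝ) => (hint P m n).const_mul x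
          have hadd : Integrable (fun u => s / (1 - q) * (1 - q ^ (n + (j + 2))) * (P.eval u *
                (ascNormalized q a b (n + (i + 1)) u * ascNormalized q a b (n + (j + 2)) u)) +
              s / (1 - q) * (1 - b / s ^ 2 * q ^ (n + j)) * (P.eval u *
                (ascNormalized q a b (n + (i + 1)) u * ascNormalized q a b (n + j) u))) μ :=
            (hi _ _ _).add (hi _ _ _)
          rw [integral_add (hi _ _ _) hadd, integral_add (hi _ _ _) (hi _ _ _),
            integral_const_mul, integral_const_mul, integral_const_mul]
          simp only [hI]
          ring
        have t1 := ih (i + 1) (j + 1)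
        have t2 := ih (i + 1) (j + 2)
        have t0 := ih (i + 1) j
        have p2 := ((tendsto_add_atTop_iff_nat (j + 2)).2 hp).const_sub 1
        have p1 := ((tendsto_add_atTop_iff_nat (j + 1)).2 hp).const_mul (a / s)
        have p0 := (((tendsto_add_atTop_iff_nat j).2 hp).const_mul (b / s ^ 2)).const_sub 1
        have hlim := ((t1.const_mul a).add
          ((((p2.mul t2).sub (p1.mul t1)).add (p0.mul t0)).const_mul s)).div_const (1 - q)
        simp_rw [hexp]
        convert hlim using 2
        have hcos : ∀ θ, (P * Polynomial.X).eval (ascPoint q a b θ) * Real.cos (((i : ℝ) - j) * θ) =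
            a / (1 - q) * (P.eval (ascPoint q a b θ) *
              Real.cos ((((i + 1 : ℕ) : ℝ) - ((j + 1 : ℕ) : ℝ)) * θ)) +
            (s / (1 - q) * (P.eval (ascPoint q a b θ) *
              Real.cos ((((i + 1 : ℕ) : ℝ) - ((j + 2 : ℕ) : ℝ)) * θ)) +
            s / (1 - q) * (P.eval (ascPoint q a b θ) *
              Real.cos ((((i + 1 : ℕ) : ℝ) - (j : ℝ)) * θ))) := fun θ => by
          have e1 : (((i + 1 : ℕ) : ℝ) - ((j + 1 : ℕ) : ℝ)) * θ = ((i : ℝ) - j) * θ := by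
            push_cast; ring
          have e2 : (((i + 1 : ℕ) : ℝ) - ((j + 2 : ℕ) : ℝ)) * θ = ((i : ℝ) - j) * θ - θ := by
            push_cast; ring
          have e0 : (((i + 1 : ℕ) : ℝ) - (j : ℝ)) * θ = ((i : ℝ) - j) * θ + θ := by
            push_cast; ring
          rw [e1, e2, e0, Real.cos_sub, Real.cos_add, Polynomial.eval_mul, Polynomial.eval_X]
          have h3 : ascPoint q a b θ = a / (1 - q) + 2 * (s / (1 - q)) * Real.cos θ := by
            rw [ascPoint, ← hsdef]; ring
          linear_combination
            P.eval (ascPoint q a b θ) * Real.cos (((i : ℝ) - j) * θ) * h3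
        simp_rw [hcos]
        have hi := fun x y => (hintc P x).const_mul y
        rw [intervalIntegral.integral_add (hi _ _) ((hi _ _).add (hi _ _)),
          intervalIntegral.integral_add (hi _ _) (hi _ _), intervalIntegral.integral_const_mul,
          intervalIntegral.integral_const_mul, intervalIntegral.integral_const_mul]
        ring
      intro i j
      refine (tendsto_add_atTop_iff_nat 1).1 ?_
      convert hstep i j using 6 with n
      all_goals first | rfl | (congr 1; omega)

end IsASCGenerator

lemma abs_ascVariable_lt_two_iff {q b : ℝ} (hq : |q| < 1) (hb : -1 + max q 0 < b) (a u : ℝ) :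
    |ascVariable q a b u| < 2 ↔ u ∈ Set.Ioo (a / (1 - q) - 2 * √(b + 1 - q) / (1 - q))
      (a / (1 - q) + 2 * √(b + 1 - q) / (1 - q)) := by
  have hs := scale_pos hb
  have hq1 : 0 < 1 - q := by linarith [(abs_lt.1 hq).2]
  rw [abs_lt, ascVariable, lt_div_iff₀ hs, div_lt_iff₀ hs, Set.mem_Ioo, ← sub_div, ← add_div,
    div_lt_iff₀ hq1, lt_div_iff₀ hq1]
  constructor <;> rintro ⟨h1, h2⟩ <;> constructor <;> linarith

lemma abs_ascVariable_le_two_iff {q b : ℝ} (hq : |q| < 1) (hb : -1 + max q 0 < b) (a u : ℝ) :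
    |ascVariable q a b u| ≤ 2 ↔ u ∈ Set.Icc (a / (1 - q) - 2 * √(b + 1 - q) / (1 - q))
      (a / (1 - q) + 2 * √(b + 1 - q) / (1 - q)) := by
  have hs := scale_pos hb
  have hq1 : 0 < 1 - q := by linarith [(abs_lt.1 hq).2]
  rw [abs_le, ascVariable, le_div_iff₀ hs, div_le_iff₀ hs, Set.mem_Icc, ← sub_div, ← add_div,
    div_le_iff₀ hq1, le_div_iff₀ hq1]
  constructor <;> rintro ⟨h1, h2⟩ <;> constructor <;> linarith

lemma continuous_ascVariable (q a b : ℝ) : Continuous (ascVariable q a b) := by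
  unfold ascVariable
  fun_prop

/-- Since `sin θ ≤ 1`, integration in `θ` dominates integration in `u`. -/
lemma integral_le_integral_ascPoint {q b : ℝ} (hq : |q| < 1) (hb : -1 + max q 0 < b) (a : ℝ)
    {φ : ℝ → ℝ} (hφ : Continuous φ) (hφ0 : ∀ u, 0 ≤ φ u) :
    ∫ u in (a / (1 - q) - 2 * √(b + 1 - q) / (1 - q))..(a / (1 - q) + 2 * √(b + 1 - q) / (1 - q)),
      φ u ≤ 2 * √(b + 1 - q) / (1 - q) * ∫ θ in (0 : ℝ)..Real.pi, φ (ascPoint q a b θ) := by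
  have hs := scale_pos hb
  have hq1 : 0 < 1 - q := by linarith [(abs_lt.1 hq).2]
  set c := 2 * √(b + 1 - q) / (1 - q) with hc
  have hc0 : 0 < c := by positivity
  have hderiv : ∀ θ ∈ Set.uIcc 0 Real.pi, HasDerivAt (ascPoint q a b) (-(c * Real.sin θ)) θ := by
    intro θ _
    have h1 := (((Real.hasDerivAt_cos θ).const_mul (2 * √(b + 1 - q))).const_add a).div_const (1 - q)
    refine h1.congr_deriv ?_
    rw [hc]; ring
  have h1 := intervalIntegral.integral_comp_mul_deriv (g := φ) hderiv
    (by fun_prop) hφ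
  have hl : ascPoint q a b 0 = a / (1 - q) + c := by rw [ascPoint, hc, Real.cos_zero]; ring
  have hr : ascPoint q a b Real.pi = a / (1 - q) - c := by rw [ascPoint, hc, Real.cos_pi]; ring
  rw [hl, hr, intervalIntegral.integral_symm (a / (1 - q) - c)] at h1
  have h2 : ∫ u in (a / (1 - q) - c)..(a / (1 - q) + c), φ u =
      ∫ θ in (0 : ℝ)..Real.pi, c * (φ (ascPoint q a b θ) * Real.sin θ) := by
    rw [← neg_inj, ← h1, ← intervalIntegral.integral_neg]
    exact intervalIntegral.integral_congr fun θ _ => by simp only [Function.comp_apply]; ring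
  have hcont := hφ.comp (continuous_ascPoint q a b)
  rw [h2, intervalIntegral.integral_const_mul]
  refine mul_le_mul_of_nonneg_left ?_ hc0.le
  refine intervalIntegral.integral_mono_on Real.pi_pos.le
    ((hcont.mul Real.continuous_sin).intervalIntegrable _ _) (hcont.intervalIntegrable _ _)
    fun θ _ => ?_
  exact mul_le_of_le_one_right (hφ0 _) (Real.sin_le_one θ)

namespace IsASCGenerator

variable {q a b : ℝ} {μ : Measure ℝ}

/-- Where `gₙ² ≤ M`, the weak limit of `gₙ² μ` is dominated by `M μ`. -/
lemma integral_ascPoint_le (h : IsASCGenerator q a b μ) (hq : |q| < 1)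
    (hb : -1 + max q 0 < b) {r : ℝ} (hr0 : 0 < r) (hr : Tendsto (ascNormSq q b) atTop (𝓝 r))
    {φ : ℝ → ℝ} (hφ : Continuous φ) (hφ0 : ∀ u, 0 ≤ φ u) {M : ℝ}
    (hM : ∀ u, φ u ≠ 0 → ∀ n, ascNormalized q a b n u ^ 2 ≤ M) :
    r / Real.pi * ∫ θ in (0 : ℝ)..Real.pi, φ (ascPoint q a b θ) ≤ M * ∫ u, φ u ∂μ := by
  have := h.isProbabilityMeasure
  have hpi := Real.pi_pos
  obtain ⟨R₁, -, hR₁⟩ := ae_abs_le_of_isCompact_support h.isCompact_support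
  obtain ⟨R₂, hR₂⟩ := (isCompact_Icc (a := (0 : ℝ)) (b := Real.pi)).exists_bound_of_continuousOn
    (continuous_ascPoint q a b).continuousOn
  set R := max R₁ R₂
  have hgc : ∀ n, Continuous (ascNormalized q a b n) := continuous_ascNormalized q a b
  refine le_of_forall_pos_le_add fun ε hε => ?_
  set η := ε / (2 * r) with hη
  have hη0 : 0 < η := by positivity
  obtain ⟨P, hP⟩ := exists_polynomial_near_of_continuousOn (-R) R φ hφ.continuousOn η hη0
  have hPφ : ∀ u, |u| ≤ R → P.eval u - η ≤ φ u ∧ φ u ≤ P.eval u + η := fun u hu => by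
    have := abs_lt.1 (hP u (abs_le.1 hu))
    constructor <;> linarith [this.1, this.2]
  have hle : ∀ n, ∫ u, P.eval u * (ascNormalized q a b (n + 0) u * ascNormalized q a b (n + 0) u) ∂μ
      - η * ascNormSq q b n ≤ M * ∫ u, φ u ∂μ := fun n => by
    have hg2 : Integrable (fun u => ascNormalized q a b n u * ascNormalized q a b n u) μ :=
      h.integrable ((hgc n).mul (hgc n))
    have hPg : Integrable
        (fun u => P.eval u * (ascNormalized q a b n u * ascNormalized q a b n u)) μ :=
      h.integrable (P.continuous.mul ((hgc n).mul (hgc n)))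
    rw [← h.integral_ascNormalized_sq hq hb, ← integral_const_mul, ← integral_const_mul, add_zero,
      ← integral_sub hPg (hg2.const_mul η)]
    refine integral_mono_ae (hPg.sub (hg2.const_mul η)) ((h.integrable hφ).const_mul M) ?_
    filter_upwards [hR₁] with u hu
    have h1 := (hPφ u (hu.trans (le_max_left _ _))).1
    have h2 := mul_self_nonneg (ascNormalized q a b n u)
    have h3 : φ u * (ascNormalized q a b n u * ascNormalized q a b n u) ≤ M * φ u := by
      by_cases h0 : φ u = 0
      · simp [h0]
      · rw [mul_comm M, ← sq]
        exact mul_le_mul_of_nonneg_left (hM u h0 n) (hφ0 u)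
    have h4 := mul_le_mul_of_nonneg_right h1 h2
    show _ - _ ≤ _
    linarith
  have hlim := (h.tendsto_integral_polynomial hq hb hr P 0 0).sub (hr.const_mul η)
  have h1 := le_of_tendsto' hlim hle
  simp only [sub_self, zero_mul, Real.cos_zero, mul_one] at h1
  have hc1 := hφ.comp (continuous_ascPoint q a b)
  have hc2 : Continuous (fun θ => P.eval (ascPoint q a b θ)) := P.continuous.comp (continuous_ascPoint q a b)
  have h2 : ∫ θ in (0 : ℝ)..Real.pi, φ (ascPoint q a b θ) ≤
      (∫ θ in (0 : ℝ)..Real.pi, P.eval (ascPoint q a b θ)) + Real.pi * η := by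
    have h3 : Real.pi * η = ∫ _θ in (0 : ℝ)..Real.pi, η := by simp
    rw [h3, ← intervalIntegral.integral_add (hc2.intervalIntegrable _ _)
      intervalIntegrable_const]
    refine intervalIntegral.integral_mono_on hpi.le (hc1.intervalIntegrable _ _)
      ((hc2.intervalIntegrable _ _).add intervalIntegrable_const) fun θ hθ => ?_
    exact (hPφ _ ((hR₂ θ hθ).trans (le_max_right _ _))).2
  have h4 := mul_le_mul_of_nonneg_left h2 (by positivity : 0 ≤ r / Real.pi)
  have h5 : r / Real.pi * ((∫ θ in (0 : ℝ)..Real.pi, P.eval (ascPoint q a b θ)) + Real.pi * η) =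
      r / Real.pi * (∫ θ in (0 : ℝ)..Real.pi, P.eval (ascPoint q a b θ)) + r * η := by
    field_simp
  have h6 : 2 * (r * η) = ε := by rw [hη]; field_simp
  linarith

/-- On sets bounded away from the end-points, `μ` dominates a multiple of Lebesgue measure. -/
lemma exists_mul_volume_le (h : IsASCGenerator q a b μ) (hq : |q| < 1)
    (hb : -1 + max q 0 < b) {δ : ℝ} (hδ : 0 < δ) :
    ∃ c > 0, ∀ F : Set ℝ, IsCompact F → F ⊆ {u | |ascVariable q a b u| < 2 - δ} →
      c * volume.real F ≤ μ.real F := by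
  have := h.isProbabilityMeasure
  obtain ⟨r, hr0, hr⟩ := exists_tendsto_ascNormSq hq hb
  obtain ⟨M, hM0, hM⟩ := QChebyshevRec.exists_sq_le hq (a / √(b + 1 - q)) (b / √(b + 1 - q) ^ 2) hδ
  have hs := scale_pos hb
  have hq1 : 0 < 1 - q := by linarith [(abs_lt.1 hq).2]
  have hpi := Real.pi_pos
  set ℓ := 2 * √(b + 1 - q) / (1 - q) with hℓ
  have hℓ0 : 0 < ℓ := by positivity
  refine ⟨r / (Real.pi * M * ℓ), by positivity, fun F hF hFJ => ?_⟩
  have hJ : IsOpen {u | |ascVariable q a b u| < 2 - δ} :=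
    isOpen_lt (continuous_ascVariable q a b).abs continuous_const
  obtain ⟨ε, hε, hthick⟩ := hF.exists_thickening_subset_open hJ hFJ
  have hpos : ∀ n : ℕ, 0 < ε / ((n : ℝ) + 1) := fun n => by positivity
  have hlim0 : Tendsto (fun n : ℕ => ε / ((n : ℝ) + 1)) atTop (𝓝 0) := by
    have := (tendsto_one_div_add_atTop_nhds_zero_nat (𝕜 := ℝ)).const_mul ε
    simpa [div_eq_mul_inv] using this
  refine ge_of_tendsto' (tendsto_integral_thickenedIndicator_of_isClosed μ hF.isClosed hpos hlim0)
    fun n => ?_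
  set φ : ℝ → ℝ := fun u => (thickenedIndicator (hpos n) F u : ℝ) with hφ
  have hφc : Continuous φ := NNReal.continuous_coe.comp (thickenedIndicator (hpos n) F).continuous
  have hφ0 : ∀ u, 0 ≤ φ u := fun u => NNReal.coe_nonneg _
  have hφM : ∀ u, φ u ≠ 0 → ∀ k, ascNormalized q a b k u ^ 2 ≤ M := fun u hu k => by
    have hmem : u ∈ Metric.thickening (ε / ((n : ℝ) + 1)) F := by
      by_contra hnot
      exact hu (congrArg NNReal.toReal (thickenedIndicator_zero (hpos n) F hnot))
    have h1 : ε / ((n : ℝ) + 1) ≤ ε := div_le_self hε.le (by linarith [n.cast_nonneg (α := ℝ)])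
    have h2 := hthick (Metric.thickening_mono h1 F hmem)
    exact hM _ _ (ascNormalized_rec hq hb a u) (le_of_lt h2) k
  have h1 := h.integral_ascPoint_le hq hb hr0 hr hφc hφ0 hφM
  have h2 := integral_le_integral_ascPoint hq hb a hφc hφ0
  have h3 : volume.real F ≤ ∫ u in (a / (1 - q) - ℓ)..(a / (1 - q) + ℓ), φ u := by
    rw [intervalIntegral.integral_of_le (by linarith)]
    have hFI : F ⊆ Set.Ioc (a / (1 - q) - ℓ) (a / (1 - q) + ℓ) := fun u hu => by
      have h4 : |ascVariable q a b u| < 2 - δ := hFJ hu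
      exact Set.Ioo_subset_Ioc_self
        ((abs_ascVariable_lt_two_iff hq hb a u).1 (by linarith))
    have hii : IntegrableOn φ (Set.Ioc (a / (1 - q) - ℓ) (a / (1 - q) + ℓ)) volume :=
      (hφc.integrableOn_Icc).mono_set Set.Ioc_subset_Icc_self
    have h5 : ∫ u in F, φ u = volume.real F := by
      rw [setIntegral_congr_fun (g := fun _ => (1 : ℝ)) hF.measurableSet fun u hu =>
        congrArg NNReal.toReal (thickenedIndicator_one (hpos n) F hu)]
      simp
    rw [← h5]
    exact setIntegral_mono_set hii (Eventually.of_forall hφ0) hFI.eventuallyLE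
  have h6 := h3.trans h2
  have h7 : r / (Real.pi * M * ℓ) * volume.real F ≤
      r / (Real.pi * M * ℓ) * (ℓ * ∫ θ in (0 : ℝ)..Real.pi, φ (ascPoint q a b θ)) :=
    mul_le_mul_of_nonneg_left h6 (by positivity)
  have h8 : r / (Real.pi * M * ℓ) * (ℓ * ∫ θ in (0 : ℝ)..Real.pi, φ (ascPoint q a b θ)) =
      (r / Real.pi * ∫ θ in (0 : ℝ)..Real.pi, φ (ascPoint q a b θ)) / M := by
    field_simp
  rw [h8] at h7
  refine h7.trans ?_
  rw [div_le_iff₀ hM0]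
  exact h1.trans_eq (mul_comm _ _)

end IsASCGenerator

/-! ### The absolutely continuous part -/

/-- If `μ` dominates a multiple of Lebesgue measure on `J`, so does its absolutely continuous part:
the singular part is carried by a Lebesgue null set. -/
lemma acPart_ne_zero {μ : Measure ℝ} [IsFiniteMeasure μ] {J : Set ℝ} (hJ : MeasurableSet J)
    (hJ0 : volume J ≠ 0) {c : ℝ} (hc : 0 < c)
    (h : ∀ F : Set ℝ, IsCompact F → F ⊆ J → c * volume.real F ≤ μ.real F) : acPart μ J ≠ 0 := by
  intro hac
  obtain ⟨S, hS, hsing, hvol⟩ := Measure.mutuallySingular_singularPart μ volume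
  have hdecomp : μ = μ.singularPart volume + acPart μ := Measure.haveLebesgueDecomposition_add μ volume
  have hμ : μ (J ∩ S) = 0 := by
    rw [hdecomp, Measure.add_apply, measure_mono_null Set.inter_subset_right hsing,
      measure_mono_null Set.inter_subset_left hac, add_zero]
  have hvolJ : 0 < volume (J ∩ S) := by
    rw [measure_inter_conull hvol]
    exact hJ0.bot_lt
  obtain ⟨F, hFJ, hF, hF0⟩ := (hJ.inter hS).exists_lt_isCompact hvolJ
  have h1 := h F hF (hFJ.trans Set.inter_subset_left)
  have h2 : μ.real F = 0 := by rw [measureReal_def, measure_mono_null hFJ hμ, ENNReal.toReal_zero]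
  have h3 : 0 < volume.real F := ENNReal.toReal_pos hF0.ne' hF.measure_lt_top.ne
  have h4 := mul_pos hc h3
  linarith

namespace IsASCGenerator

variable {q a b : ℝ} {μ : Measure ℝ}

lemma acPart_compl_Ioo (h : IsASCGenerator q a b μ) (hq : |q| < 1) (hb : -1 + max q 0 < b) :
    acPart μ (Set.Ioo (a / (1 - q) - 2 * √(b + 1 - q) / (1 - q))
      (a / (1 - q) + 2 * √(b + 1 - q) / (1 - q)))ᶜ = 0 := by
  have := h.isProbabilityMeasure
  set l := a / (1 - q) - 2 * √(b + 1 - q) / (1 - q) with hl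
  set r := a / (1 - q) + 2 * √(b + 1 - q) / (1 - q) with hr
  have hac : acPart μ ≪ volume := withDensity_absolutelyContinuous _ _
  have hle : acPart μ ≤ μ := Measure.withDensity_rnDeriv_le μ volume
  have hcount : (ascExceptionalSet q a b ∪ {l, r}).Countable :=
    (countable_ascExceptionalSet hq hb a).union (Set.toFinite _).countable
  have h1 : ∀ᵐ u ∂(acPart μ), |ascVariable q a b u| ≤ 2 ∨ u ∈ ascExceptionalSet q a b :=
    (Measure.absolutelyContinuous_of_le hle).ae_le (h.ae_abs_le_two_or_mem hq hb)
  have h2 : ∀ᵐ u ∂(acPart μ), u ∉ ascExceptionalSet q a b ∪ {l, r} :=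
    measure_eq_zero_iff_ae_notMem.1 (hac (hcount.measure_zero volume))
  rw [measure_eq_zero_iff_ae_notMem]
  filter_upwards [h1, h2] with u hu1 hu2
  simp only [Set.mem_union, Set.mem_insert_iff, Set.mem_singleton_iff, not_or] at hu2
  have h3 := (abs_ascVariable_le_two_iff hq hb a u).1 (hu1.resolve_right hu2.1)
  exact not_not.2 ⟨lt_of_le_of_ne h3.1 (Ne.symm hu2.2.1), lt_of_le_of_ne h3.2 hu2.2.2⟩

lemma support_acPart (h : IsASCGenerator q a b μ) (hq : |q| < 1) (hb : -1 + max q 0 < b) :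
    (acPart μ).support = Set.Icc (a / (1 - q) - 2 * √(b + 1 - q) / (1 - q))
      (a / (1 - q) + 2 * √(b + 1 - q) / (1 - q)) := by
  have := h.isProbabilityMeasure
  have hnull := h.acPart_compl_Ioo hq hb
  have hs := scale_pos hb
  have hq1 : 0 < 1 - q := by linarith [(abs_lt.1 hq).2]
  have hℓ0 : 0 < 2 * √(b + 1 - q) / (1 - q) := by positivity
  have hiff := abs_ascVariable_lt_two_iff hq hb a
  set l := a / (1 - q) - 2 * √(b + 1 - q) / (1 - q) with hl
  set r := a / (1 - q) + 2 * √(b + 1 - q) / (1 - q) with hr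
  refine Set.Subset.antisymm ?_ fun x hx => ?_
  · exact Measure.support_subset_of_isClosed isClosed_Icc
      (measure_mono_null (Set.compl_subset_compl.2 Set.Ioo_subset_Icc_self) hnull)
  · rw [Measure.mem_support_iff_forall]
    intro U hU
    rw [← closure_Ioo (by linarith : l ≠ r)] at hx
    obtain ⟨V, hVU, hV, hxV⟩ := mem_nhds_iff.1 hU
    obtain ⟨x', hx'V, hx'⟩ := mem_closure_iff.1 hx V hV hxV
    -- a neighbourhood of `x'` in `V` on which `|y|` stays away from `2`
    have hy : |ascVariable q a b x'| < 2 := (hiff x').2 hx'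
    set δ := (2 - |ascVariable q a b x'|) / 2 with hδ
    have hδ0 : 0 < δ := by rw [hδ]; linarith
    have hJo : IsOpen (V ∩ {u | |ascVariable q a b u| < 2 - δ}) :=
      hV.inter (isOpen_lt (continuous_ascVariable q a b).abs continuous_const)
    have hne : (V ∩ {u | |ascVariable q a b u| < 2 - δ}).Nonempty :=
      ⟨x', hx'V, by show |ascVariable q a b x'| < 2 - δ; rw [hδ]; linarith⟩
    obtain ⟨c, hc, hF⟩ := h.exists_mul_volume_le hq hb hδ0
    have h0 := acPart_ne_zero hJo.measurableSet (hJo.measure_pos volume hne).ne' hc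
      fun F hFc hFJ => hF F hFc (hFJ.trans Set.inter_subset_right)
    exact h0.bot_lt.trans_le (measure_mono (Set.inter_subset_left.trans hVU))

end IsASCGenerator

/-! ### `q`-exponential families with quadratic variance function -/

theorem theorem3p1 (q a b : ℝ) (hq₀ : -1 < q) (hq₁ : q < 1) (hb : -1 + max q 0 < b)
    (A B : EReal) (μ : Measure ℝ) (w : ℝ → ℝ → ℝ)
    (hF : IsQExponentialFamily q (fun m => 1 + a * m + b * m ^ 2) A B μ w) :
    -- the product formula for the density (in it no denominator vanishes)
    (∀ m ∈ openInterval A B, q * m ∈ openInterval A B → ∀ u ∈ μ.support,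
      (∀ k : ℕ,
        1 + (a - (1 - q) * u) * m * q ^ k + (b + 1 - q) * m ^ 2 * q ^ (2 * k) ≠ 0) ∧
      HasProd (fun k : ℕ =>
        (1 + a * m * q ^ k + b * m ^ 2 * q ^ (2 * k)) /
          (1 + (a - (1 - q) * u) * m * q ^ k + (b + 1 - q) * m ^ 2 * q ^ (2 * k)))
        (w m u)) ∧
    -- the generating measure is a uniquely determined probability measure
    IsProbabilityMeasure μ ∧
    (∀ (A' B' : EReal) (μ' : Measure ℝ) (w' : ℝ → ℝ → ℝ),
      IsQExponentialFamily q (fun m => 1 + a * m + b * m ^ 2) A' B' μ' w' → μ' = μ) ∧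
    -- it is the orthogonality measure of the Al-Salam-Chihara polynomials
    IsOrthogonalityMeasure μ (alSalamChihara q a b) ∧
    (∀ ν : Measure ℝ, IsProbabilityMeasure ν →
      IsOrthogonalityMeasure ν (alSalamChihara q a b) → ν = μ) ∧
    -- the absolutely continuous part lives on the stated interval, and its support is all of it
    acPart μ (Set.Ioo (a / (1 - q) - 2 * √(b + 1 - q) / (1 - q))
      (a / (1 - q) + 2 * √(b + 1 - q) / (1 - q)))ᶜ = 0 ∧
    (acPart μ).support = Set.Icc (a / (1 - q) - 2 * √(b + 1 - q) / (1 - q))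
      (a / (1 - q) + 2 * √(b + 1 - q) / (1 - q)) ∧
    -- no discrete part
    (a ^ 2 < 4 * b → ∀ x : ℝ, μ {x} = 0) := by
  have hq : |q| < 1 := abs_lt.2 ⟨hq₀, hq₁⟩
  have h := hF.isASCGenerator hq hb
  refine ⟨fun m hm hqm u hu => ?_, h.isProbabilityMeasure,
    fun A' B' μ' w' hF' => ?_, h.isOrthogonalityMeasure hq hb,
    fun ν _ hν => h.eq_of_isOrthogonalityMeasure hν, h.acPart_compl_Ioo hq hb,
    h.support_acPart hq hb, fun hab x => h.measure_singleton_eq_zero hq hb hab x⟩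
  · have hnum : ∀ k : ℕ, 1 + a * m * q ^ k + b * m ^ 2 * q ^ (2 * k) =
        1 + a * (q ^ k * m) + b * (q ^ k * m) ^ 2 := fun k => by ring
    have hden : ∀ k : ℕ,
        1 + (a - (1 - q) * u) * m * q ^ k + (b + 1 - q) * m ^ 2 * q ^ (2 * k) =
          1 + (a - (1 - q) * u) * (q ^ k * m) + (b + 1 - q) * (q ^ k * m) ^ 2 := fun k => by ring
    simp_rw [hnum, hden]
    exact ⟨hF.den_ne_zero hq hm hqm hu, hF.hasProd hq hm hqm hu⟩
  · have h' := hF'.isASCGenerator hq hb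
    have := h'.isProbabilityMeasure
    exact h.eq_of_isOrthogonalityMeasure (h'.isOrthogonalityMeasure hq hb)
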